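/- Let $k$ be a field of characteristic $p>0$ and let $A=k[x]/(x^p)$, graded with $\deg x=2$. For a $k$-vector space $X$ let $\Gamma^d(X)=(X^{\otimes d})^{\Sigma_d}$ be the space of symmetric $d$-tensors, graded by total degree if $X$ is graded. A graded $k$-linear category is a $k$-linear category with $\mathbb Z$-graded Hom spaces in which identities have degree $0$ and degrees add under composition; a graded functor is a $k$-linear functor preserving degrees of morphisms. Let $\Gamma^d\mathcal V_A$ be the graded $k$-linear category with objects $V\otimes A$, for $V$ a finite-dimensional $k$-vector space, and $\mathrm{Hom}(V\otimes A,W\otimes A)=\Gamma^d(\mathrm{Hom}_k(V,W)\otimes A)$ with componentwise composition. Let $\mathcal V^{f+}$ be the graded category of $\mathbb Z$-graded $k$-vector spaces that are bounded below and finite-dimensional in each degree, with morphisms the finite sums of homogeneous linear maps. Let $\mathcal P_d^{af}$ be the graded category of graded functors $F:\Gamma^d\mathcal V_A\to\mathcal V^{f+}$, with $\mathrm{Hom}(F,G)=\bigoplus_{j\in\mathbb Z}\mathrm{Nat}^j(F,G)$, where $\mathrm{Nat}^j(F,G)$ is the space of natural transformations all of whose components are homogeneous of degree $j$. For $n\ge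 0$ let $S_{d,n}^{af}=\Gamma^d(\mathrm{End}(k^n)\otimes A)$, a graded subalgebra of $(\mathrm{End}(k^n)\otimes A)^{\otimes d}$, and let $S_{d,n}^{af}\text{-mod}^{f+}$ be the graded category of $\mathbb Z$-graded left $S_{d,n}^{af}$-modules that are bounded below and finite-dimensional over $k$ in each degree, with morphisms the finite sums of homogeneous $S_{d,n}^{af}$-linear maps. For $F\in\mathcal P_d^{af}$ the space $F(A^n)=F(k^n\otimes A)$ is such a module, because $S_{d,n}^{af}$ is the endomorphism algebra of $A^n$ in $\Gamma^d\mathcal V_A$. A graded abelian category is a graded $k$-linear category whose degree-$0$ morphisms form an abelian category and in which, for every object $X$ and every $j\in\mathbb Z$, there is an isomorphism of degree $j$ from $X$ to some object. **Proposition 2.5.** If $n\ge d$, then $$ev_n:\mathcal P_d^{af}\longrightarrow S_{d,n}^{af}\text{-mod}^{f+},\qquad F\mapsto F(A^n),$$ is an equivalence of graded abelian categories: both categories are graded abelian, and $ev_n$ is a graded functor that has a graded quasi-inverse, with both composites isomorphic to the identity functors through natural isomorphisms of degree $0$. -/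

import Mathlib

open CategoryTheory TensorProduct

universe u v w v' w'

namespace AffineSPF

/-! ### Linear algebra of internal gradings -/

section Gradings

variable {k : Type*} [Field k]

theorem isInternal_of_basis {M ι : Type*} [AddCommGroup M] [Module k M]
    (b : Module.Basis ι k M) (deg : ι → ℤ) (N : ℤ → Submodule k M)
    (hN : ∀ m, N m = Submodule.span k (b '' {i | deg i = m})) : DirectSum.IsInternal N := by
  refine DirectSum.isInternal_submodule_of_iSupIndep_of_iSup_eq_top ?_ ?_
  · intro m
    have h : (⨆ j, ⨆ _ : j ≠ m, N j) ≤ Submodule.span k (b '' {i | deg i ≠ m}) := by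
      refine iSup₂_le fun j hj => ?_
      rw [hN]
      refine Submodule.span_mono (Set.image_mono ?_)
      rintro i rfl
      exact hj
    refine Disjoint.mono_right h ?_
    rw [hN]
    refine b.linearIndependent.disjoint_span_image ?_
    exact Set.disjoint_left.mpr fun i hi hi' => hi' hi
  · rw [eq_top_iff, ← b.span_eq, Submodule.span_le]
    rintro _ ⟨i, rfl⟩
    refine Submodule.mem_iSup_of_mem (deg i) ?_
    rw [hN]
    exact Submodule.subset_span ⟨i, rfl, rfl⟩

/-- An independent family `N` induces an internal grading of every submodule `G` each of whose
elements is a finite sum of elements of the `N i ⊓ G`. -/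
theorem isInternal_comap {M : Type*} [AddCommGroup M] [Module k M] (N : ℤ → Submodule k M)
    (h : iSupIndep N) (G : Submodule k M)
    (hG : ∀ t ∈ G, ∃ f : ℤ →₀ M, (∀ i, f i ∈ N i) ∧ (∀ i, f i ∈ G) ∧ f.sum (fun _ x => x) = t) :
    DirectSum.IsInternal fun j => (N j).comap G.subtype := by
  refine DirectSum.isInternal_submodule_of_iSupIndep_of_iSup_eq_top ?_ ?_
  · rw [iSupIndep_iff_finsetSum_eq_zero_imp_eq_zero] at h ⊢
    intro s v hv hv0 i hi
    have := h s (fun i => (v i : M)) hv (by simpa using congrArg G.subtype hv0) i hi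
    exact Subtype.ext this
  · rw [eq_top_iff]
    rintro ⟨t, ht⟩ -
    obtain ⟨f, hf, hfG, rfl⟩ := hG t ht
    have : (⟨f.sum fun _ x => x, ht⟩ : G) = ∑ i ∈ f.support, ⟨f i, hfG i⟩ := by
      apply Subtype.ext
      simp [Finsupp.sum]
    rw [this]
    exact Submodule.sum_mem _ fun i _ => Submodule.mem_iSup_of_mem i (hf i)

/-- The pieces of an independent family form an internal grading of their sum. -/
theorem isInternal_iSup {M : Type*} [AddCommGroup M] [Module k M] (N : ℤ → Submodule k M)
    (h : iSupIndep N) :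
    DirectSum.IsInternal fun j => (N j).comap (⨆ j, N j).subtype := by
  refine isInternal_comap N h _ fun t ht => ?_
  obtain ⟨f, hf, rfl⟩ := (Submodule.mem_iSup_iff_exists_finsupp ..).mp ht
  exact ⟨f, hf, fun i => Submodule.mem_iSup_of_mem i (hf i), rfl⟩

/-- The invariants of operators that preserve an internal grading are graded. -/
theorem isInternal_invariants {M τ : Type*} [AddCommGroup M] [Module k M] (N : ℤ → Submodule k M)
    (h : DirectSum.IsInternal N) (σ : τ → M →ₗ[k] M) (hσ : ∀ s m, ∀ x ∈ N m, σ s x ∈ N m)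
    (G : Submodule k M) (hG : ∀ x, x ∈ G ↔ ∀ s, σ s x = x) :
    DirectSum.IsInternal fun j => (N j).comap G.subtype := by
  refine isInternal_comap N h.submodule_iSupIndep _ fun t ht => ?_
  have hmem : t ∈ ⨆ j, N j := by rw [h.submodule_iSup_eq_top]; trivial
  obtain ⟨f, hf, rfl⟩ := (Submodule.mem_iSup_iff_exists_finsupp ..).mp hmem
  refine ⟨f, hf, fun i => ?_, rfl⟩
  rw [hG]
  intro s
  by_cases hi : i ∈ f.support
  · have h1 := (hG _).mp ht s
    rw [Finsupp.sum, map_sum] at h1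
    exact (iSupIndep_iff_finsetSum_eq_imp_eq N).mp h.submodule_iSupIndep f.support
      (fun i => σ s (f i)) f (fun i _ => ⟨hσ s i _ (hf i), hf i⟩) h1 i hi
  · rw [Finsupp.notMem_support_iff.mp hi, map_zero]

theorem exists_homogeneous_basis {M : Type v} [AddCommGroup M] [Module k M]
    {N : ℤ → Submodule k M} (h : DirectSum.IsInternal N) :
    ∃ (ι : Type v) (b : Module.Basis ι k M) (deg : ι → ℤ), ∀ m,
      N m = Submodule.span k (b '' {i | deg i = m}) := by
  let v : ∀ i, Module.Basis (Module.Basis.ofVectorSpaceIndex k (N i)) k (N i) :=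
    fun i => Module.Basis.ofVectorSpace k (N i)
  refine ⟨Σ i, Module.Basis.ofVectorSpaceIndex k (N i),
    h.collectedBasis (α := fun i => Module.Basis.ofVectorSpaceIndex k (N i)) v,
    fun i => i.1, fun m => le_antisymm (fun x hx => ?_) ?_⟩
  · have h1 : (⟨x, hx⟩ : N m) ∈ Submodule.span k (Set.range (v m)) := by
      rw [(v m).span_eq]; trivial
    have h2 := Submodule.mem_map_of_mem (f := (N m).subtype) h1
    rw [Submodule.map_span] at h2
    refine Submodule.span_mono ?_ h2
    rintro _ ⟨_, ⟨i, rfl⟩, rfl⟩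
    exact ⟨⟨m, i⟩, rfl, by simp⟩
  · rw [Submodule.span_le]
    rintro _ ⟨i, rfl, rfl⟩
    exact h.collectedBasis_mem v i

/-- If `B (P i) (Q j) ⊆ R (i + j)` then `B` maps the sums of the pieces to the sum of the pieces. -/
theorem iSup_mem_of_bilin {P Q R : Type*} [AddCommGroup P] [Module k P] [AddCommGroup Q]
    [Module k Q] [AddCommGroup R] [Module k R] (B : P →ₗ[k] Q →ₗ[k] R)
    (PP : ℤ → Submodule k P) (QQ : ℤ → Submodule k Q) (RR : ℤ → Submodule k R)
    (hB : ∀ i j x y, x ∈ PP i → y ∈ QQ j → B x y ∈ RR (i + j)) {x : P} {y : Q}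
    (hx : x ∈ ⨆ i, PP i) (hy : y ∈ ⨆ j, QQ j) : B x y ∈ ⨆ l, RR l := by
  have h1 : ∀ i, ∀ x ∈ PP i, (⨆ j, QQ j) ≤ (⨆ l, RR l).comap (B x) := fun i x hx =>
    iSup_le fun j y hy => Submodule.mem_iSup_of_mem (i + j) (hB i j x y hx hy)
  have h2 : (⨆ i, PP i) ≤ (⨆ l, RR l).comap (B.flip y) :=
    iSup_le fun i x hx => h1 i x hx hy
  exact h2 hx

end Gradings

/-! ### Graded linear categories -/

section GradedCategories

/-- A graded `k`-linear category: the Hom spaces are `ℤ`-graded `k`-vector spaces, identities have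
degree `0`, and degrees add under composition. -/
class GradedCategory (k : Type u) [Field k] (C : Type w) [Category.{v} C] [Preadditive C]
    [Linear k C] where
  /-- the space of morphisms of degree `j` -/
  deg (X Y : C) (j : ℤ) : Submodule k (X ⟶ Y)
  isInternal (X Y : C) : DirectSum.IsInternal (deg X Y)
  id_mem (X : C) : 𝟙 X ∈ deg X X 0
  comp_mem {X Y Z : C} {i j : ℤ} {f : X ⟶ Y} {g : Y ⟶ Z} (hf : f ∈ deg X Y i)
    (hg : g ∈ deg Y Z j) : f ≫ g ∈ deg X Z (i + j)

variable (k : Type u) [Field k]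

/-- The category with the objects of a graded category `C` and its morphisms of degree `0`. -/
structure DegZero (k : Type u) (C : Type w) where
  /-- an object of `C` as an object of the category of morphisms of degree `0` -/
  of ::
  /-- the underlying object of `C` -/
  obj : C

section

variable (C : Type w) [Category.{v} C] [Preadditive C] [Linear k C] [GradedCategory k C]

instance : Category.{v} (DegZero k C) where
  Hom X Y := GradedCategory.deg (k := k) X.obj Y.obj 0
  id X := ⟨𝟙 X.obj, GradedCategory.id_mem X.obj⟩
  comp f g := ⟨f.1 ≫ g.1, by simpa using GradedCategory.comp_mem f.2 g.2⟩
  id_comp f := Subtype.ext (Category.id_comp f.1)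
  comp_id f := Subtype.ext (Category.comp_id f.1)
  assoc f g h := Subtype.ext (Category.assoc f.1 g.1 h.1)

instance : Preadditive (DegZero k C) where
  homGroup X Y := inferInstanceAs (AddCommGroup (GradedCategory.deg (k := k) X.obj Y.obj 0))
  add_comp _ _ _ f f' g := Subtype.ext (Preadditive.add_comp _ _ _ f.1 f'.1 g.1)
  comp_add _ _ _ f g g' := Subtype.ext (Preadditive.comp_add _ _ _ f.1 g.1 g'.1)

/-- A graded abelian category: a graded `k`-linear category whose morphisms of degree `0` form an
abelian category (for the given addition of morphisms) and which has shifts: every object `X` has,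
for every `j : ℤ`, an isomorphism of degree `j` onto some object (`X` with its grading moved
by `j`). -/
def IsGradedAbelian : Prop :=
  (∃ a : Abelian (DegZero k C), a.toPreadditive = (inferInstance : Preadditive (DegZero k C))) ∧
    ∀ (X : C) (j : ℤ), ∃ (Y : C) (e : X ≅ Y),
      e.hom ∈ GradedCategory.deg (k := k) X Y j ∧ e.inv ∈ GradedCategory.deg (k := k) Y X (-j)

end

variable (C : Type w) [Category.{v} C] [Preadditive C] [Linear k C] [GradedCategory k C]
  (D : Type w') [Category.{v'} D] [Preadditive D] [Linear k D] [GradedCategory k D]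

/-- A graded `k`-linear functor: a `k`-linear functor that preserves the degrees of morphisms. -/
structure GradedFunctor where
  /-- the underlying functor -/
  toFunctor : C ⥤ D
  additive : toFunctor.Additive
  linear : toFunctor.Linear k
  map_mem {X Y : C} {j : ℤ} {f : X ⟶ Y} (hf : f ∈ GradedCategory.deg (k := k) X Y j) :
    toFunctor.map f ∈ GradedCategory.deg (k := k) (toFunctor.obj X) (toFunctor.obj Y) j

namespace GradedFunctor

attribute [instance] GradedFunctor.additive GradedFunctor.linear

variable {k C D}

/-- The natural transformations all of whose components are homogeneous of degree `j`. -/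
def natDeg (F G : GradedFunctor k C D) (j : ℤ) : Submodule k (F.toFunctor ⟶ G.toFunctor) where
  carrier := {η | ∀ X, η.app X ∈ GradedCategory.deg (k := k) (F.toFunctor.obj X) (G.toFunctor.obj X) j}
  add_mem' ha hb X := Submodule.add_mem _ (ha X) (hb X)
  zero_mem' _ := Submodule.zero_mem _
  smul_mem' c _ ha X := Submodule.smul_mem _ c (ha X)

theorem natDeg_indep (F G : GradedFunctor k C D) : iSupIndep (natDeg F G) := by
  rw [iSupIndep_iff_finsetSum_eq_zero_imp_eq_zero]
  intro s v hv hv0 i hi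
  ext X
  have h := (GradedCategory.isInternal (k := k) (F.toFunctor.obj X)
    (G.toFunctor.obj X)).submodule_iSupIndep
  rw [iSupIndep_iff_finsetSum_eq_zero_imp_eq_zero] at h
  refine h s (fun i => (v i).app X) (fun i hi => hv i hi X) ?_ i hi
  have := congrArg (fun η => NatTrans.app η X) hv0
  simpa using this

/-- The morphisms between graded functors are the finite sums of homogeneous natural
transformations. -/
def homs (F G : GradedFunctor k C D) : Submodule k (F.toFunctor ⟶ G.toFunctor) :=
  ⨆ j, natDeg F G j

theorem comp_mem_natDeg {F G H : GradedFunctor k C D} {i j : ℤ} {η : F.toFunctor ⟶ G.toFunctor}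
    {θ : G.toFunctor ⟶ H.toFunctor} (hη : η ∈ natDeg F G i) (hθ : θ ∈ natDeg G H j) :
    η ≫ θ ∈ natDeg F H (i + j) := fun X => GradedCategory.comp_mem (hη X) (hθ X)

instance : Category.{max w v'} (GradedFunctor k C D) where
  Hom F G := homs F G
  id F := ⟨𝟙 F.toFunctor, Submodule.mem_iSup_of_mem 0 fun _ => GradedCategory.id_mem _⟩
  comp f g := ⟨f.1 ≫ g.1, iSup_mem_of_bilin (Linear.comp _ _ _) _ _ _
    (fun _ _ _ _ hη hθ => comp_mem_natDeg hη hθ) f.2 g.2⟩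
  id_comp f := Subtype.ext (Category.id_comp f.1)
  comp_id f := Subtype.ext (Category.comp_id f.1)
  assoc f g h := Subtype.ext (Category.assoc f.1 g.1 h.1)

instance : Preadditive (GradedFunctor k C D) where
  homGroup F G := inferInstanceAs (AddCommGroup (homs F G))
  add_comp _ _ _ f f' g := Subtype.ext (Preadditive.add_comp _ _ _ f.1 f'.1 g.1)
  comp_add _ _ _ f g g' := Subtype.ext (Preadditive.comp_add _ _ _ f.1 g.1 g'.1)

instance : Linear k (GradedFunctor k C D) where
  homModule F G := inferInstanceAs (Module k (homs F G))
  smul_comp _ _ _ r f g := Subtype.ext (Linear.smul_comp _ _ _ r f.1 g.1)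
  comp_smul _ _ _ f r g := Subtype.ext (Linear.comp_smul _ _ _ f.1 r g.1)

/-- Graded functors form a graded category, with `Hom(F, G) = ⨁ⱼ Natʲ(F, G)`. -/
instance : GradedCategory k (GradedFunctor k C D) where
  deg F G j := (natDeg F G j).comap (homs F G).subtype
  isInternal F G := isInternal_iSup _ (natDeg_indep F G)
  id_mem _ := fun _ => GradedCategory.id_mem _
  comp_mem hf hg := comp_mem_natDeg hf hg

variable (k C) in
/-- The identity as a graded functor. -/
def id : GradedFunctor k C C where
  toFunctor := 𝟭 C
  additive := inferInstance
  linear := inferInstance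
  map_mem hf := hf

variable {E : Type*} [Category* E] [Preadditive E] [Linear k E] [GradedCategory k E]

/-- The composition of graded functors. -/
def comp (F : GradedFunctor k C D) (G : GradedFunctor k D E) : GradedFunctor k C E where
  toFunctor := F.toFunctor ⋙ G.toFunctor
  additive := inferInstance
  linear := inferInstance
  map_mem hf := G.map_mem (F.map_mem hf)

/-- A graded functor is an equivalence of graded categories if it has a graded quasi-inverse, up
to natural isomorphisms of degree `0`. -/
def IsEquivalence (F : GradedFunctor k C D) : Prop :=
  ∃ G : GradedFunctor k D C,
    Nonempty (DegZero.of (F.comp G) ≅ (DegZero.of (id k C) : DegZero k (GradedFunctor k C C))) ∧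
    Nonempty (DegZero.of (G.comp F) ≅ (DegZero.of (id k D) : DegZero k (GradedFunctor k D D)))

end GradedFunctor

end GradedCategories

section DividedPowers

open PiTensorProduct

/-- `Γ^d(E) = (E^{⊗ d})^{Σ_d}`, the space of symmetric `d`-tensors on `E`. -/
def divPow (k : Type u) [Field k] (d : ℕ) (E : Type v) [AddCommGroup E] [Module k E] :
    Submodule k (⨂[k] _ : Fin d, E) where
  carrier := {t | ∀ σ : Equiv.Perm (Fin d), reindex k (fun _ => E) σ t = t}
  add_mem' ha hb σ := by rw [map_add, ha σ, hb σ]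
  zero_mem' σ := map_zero _
  smul_mem' c _ ha σ := by rw [map_smul, ha σ]

section

variable {k : Type u} [Field k] {d : ℕ} {E : Type v} [AddCommGroup E] [Module k E]
  {E' : Type v'} [AddCommGroup E'] [Module k E'] {E'' : Type w} [AddCommGroup E''] [Module k E'']

/-- The degree `m` part of the `d`-th tensor power of a graded vector space, spanned by the tensors
`e₁ ⊗ ⋯ ⊗ e_d` of homogeneous elements whose degrees add up to `m`. -/
def tensorDeg (d : ℕ) (N : ℤ → Submodule k E) (m : ℤ) : Submodule k (⨂[k] _ : Fin d, E) :=
  Submodule.span k {t | ∃ (a : Fin d → ℤ) (e : Fin d → E), (∀ l, e l ∈ N (a l)) ∧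
    ∑ l, a l = m ∧ t = tprod k e}

/-- The degree `m` part of `Γ^d(E)` for a graded vector space `E`. -/
def divPowDeg (d : ℕ) (N : ℤ → Submodule k E) (m : ℤ) : Submodule k (divPow k d E) :=
  (tensorDeg d N m).comap (divPow k d E).subtype

theorem tensorDeg_isInternal (N : ℤ → Submodule k E) (hN : DirectSum.IsInternal N) :
    DirectSum.IsInternal (tensorDeg d N) := by
  obtain ⟨ι, b, deg, hb⟩ := exists_homogeneous_basis hN
  refine isInternal_of_basis (Basis.piTensorProduct fun _ : Fin d => b)
    (fun p => ∑ l, deg (p l)) _ fun m => le_antisymm ?_ ?_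
  · refine Submodule.span_le.mpr ?_
    rintro _ ⟨a, e, he, rfl, rfl⟩
    rw [SetLike.mem_coe, Module.Basis.mem_span_image]
    intro p hp
    rw [Finset.mem_coe, Finsupp.mem_support_iff, Basis.piTensorProduct_repr_tprod_apply,
      Finset.prod_ne_zero_iff] at hp
    refine Finset.sum_congr rfl fun l _ => ?_
    have h := he l
    rw [hb, Module.Basis.mem_span_image] at h
    exact h (Finsupp.mem_support_iff.mpr (hp l (Finset.mem_univ l)))
  · refine Submodule.span_le.mpr ?_
    rintro _ ⟨p, rfl, rfl⟩
    refine Submodule.subset_span ⟨fun l => deg (p l), fun l => b (p l), fun l => ?_, rfl, ?_⟩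
    · rw [hb]
      exact Submodule.subset_span ⟨p l, rfl, rfl⟩
    · rw [Basis.piTensorProduct_apply]

theorem reindex_mem_tensorDeg (N : ℤ → Submodule k E) (σ : Equiv.Perm (Fin d)) (m : ℤ)
    (t : ⨂[k] _ : Fin d, E) (ht : t ∈ tensorDeg d N m) :
    reindex k (fun _ => E) σ t ∈ tensorDeg d N m := by
  have h : tensorDeg d N m ≤
      (tensorDeg d N m).comap (reindex k (fun _ : Fin d => E) σ).toLinearMap := by
    refine Submodule.span_le.mpr ?_
    rintro _ ⟨a, e, he, rfl, rfl⟩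
    refine Submodule.subset_span ⟨fun l => a (σ.symm l), fun l => e (σ.symm l),
      fun l => he _, Equiv.sum_comp σ.symm a, ?_⟩
    exact reindex_tprod σ e
  exact h ht

theorem divPowDeg_isInternal (N : ℤ → Submodule k E) (hN : DirectSum.IsInternal N) :
    DirectSum.IsInternal (divPowDeg d N) :=
  isInternal_invariants (tensorDeg d N) (tensorDeg_isInternal N hN)
    (fun σ : Equiv.Perm (Fin d) => (reindex k (fun _ => E) σ).toLinearMap)
    (fun σ m t ht => reindex_mem_tensorDeg N σ m t ht) _ fun _ => Iff.rfl

/-- The componentwise bilinear map on tensor powers commutes with permutations. -/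
theorem map₂_mem_divPow (B : E →ₗ[k] E' →ₗ[k] E'') {s : ⨂[k] _ : Fin d, E}
    {t : ⨂[k] _ : Fin d, E'} (hs : s ∈ divPow k d E) (ht : t ∈ divPow k d E') :
    PiTensorProduct.map₂ (fun _ : Fin d => B) s t ∈ divPow k d E'' := by
  intro σ
  have h : ∀ (s : ⨂[k] _ : Fin d, E) (t : ⨂[k] _ : Fin d, E'),
      reindex k (fun _ => E'') σ (PiTensorProduct.map₂ (fun _ : Fin d => B) s t) =
        PiTensorProduct.map₂ (fun _ : Fin d => B) (reindex k (fun _ => E) σ s) (reindex k (fun _ => E') σ t) := by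
    intro s t
    induction s using PiTensorProduct.induction_on with
    | add s s' hs hs' => simp only [map_add, LinearMap.add_apply, hs, hs']
    | smul_tprod r x =>
      induction t using PiTensorProduct.induction_on with
      | add t t' ht ht' => simp only [map_add, ht, ht']
      | smul_tprod q y =>
        simp only [map_smul, LinearMap.smul_apply, map₂_tprod_tprod, reindex_tprod]
  rw [h, hs σ, ht σ]

theorem map₂_mem_tensorDeg (B : E →ₗ[k] E' →ₗ[k] E'') {N : ℤ → Submodule k E}
    {N' : ℤ → Submodule k E'} {N'' : ℤ → Submodule k E''}
    (hB : ∀ i j x y, x ∈ N i → y ∈ N' j → B x y ∈ N'' (i + j)) {i j : ℤ}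
    {s : ⨂[k] _ : Fin d, E} {t : ⨂[k] _ : Fin d, E'}
    (hs : s ∈ tensorDeg d N i) (ht : t ∈ tensorDeg d N' j) :
    PiTensorProduct.map₂ (fun _ : Fin d => B) s t ∈ tensorDeg d N'' (i + j) := by
  induction hs using Submodule.span_induction with
  | zero => simp
  | add x y _ _ hx hy => rw [map_add]; exact Submodule.add_mem _ hx hy
  | smul a x _ hx => rw [map_smul]; exact Submodule.smul_mem _ a hx
  | mem x hx =>
    obtain ⟨a, e, he, rfl, rfl⟩ := hx
    induction ht using Submodule.span_induction with
    | zero => simp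
    | add x y _ _ hx hy => rw [map_add]; exact Submodule.add_mem _ hx hy
    | smul a x _ hx => rw [map_smul]; exact Submodule.smul_mem _ a hx
    | mem y hy =>
      obtain ⟨a', e', he', rfl, rfl⟩ := hy
      rw [map₂_tprod_tprod]
      exact Submodule.subset_span ⟨fun l => a l + a' l, fun l => B (e l) (e' l),
        fun l => hB _ _ _ _ (he l) (he' l), Finset.sum_add_distrib, rfl⟩

theorem map₂_unit_left (B : E →ₗ[k] E' →ₗ[k] E') (e : E) (he : ∀ x, B e x = x)
    (t : ⨂[k] _ : Fin d, E') :
    PiTensorProduct.map₂ (fun _ : Fin d => B) (tprod k fun _ => e) t = t := by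
  induction t using PiTensorProduct.induction_on with
  | add t t' ht ht' => rw [map_add, ht, ht']
  | smul_tprod r x => simp only [map_smul, map₂_tprod_tprod, he]

theorem map₂_unit_right (B : E →ₗ[k] E' →ₗ[k] E) (e : E') (he : ∀ x, B x e = x)
    (t : ⨂[k] _ : Fin d, E) :
    PiTensorProduct.map₂ (fun _ : Fin d => B) t (tprod k fun _ => e) = t := by
  induction t using PiTensorProduct.induction_on with
  | add t t' ht ht' => rw [map_add, LinearMap.add_apply, ht, ht']
  | smul_tprod r x => simp only [map_smul, LinearMap.smul_apply, map₂_tprod_tprod, he]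

theorem map₂_swap (B : E →ₗ[k] E' →ₗ[k] E'') (B' : E' →ₗ[k] E →ₗ[k] E'')
    (h : ∀ x y, B x y = B' y x) (s : ⨂[k] _ : Fin d, E) (t : ⨂[k] _ : Fin d, E') :
    PiTensorProduct.map₂ (fun _ : Fin d => B) s t =
      PiTensorProduct.map₂ (fun _ : Fin d => B') t s := by
  induction s using PiTensorProduct.induction_on with
  | add s s' hs hs' => simp only [map_add, LinearMap.add_apply, hs, hs']
  | smul_tprod c x =>
    induction t using PiTensorProduct.induction_on with
    | add t t' ht ht' => simp only [map_add, LinearMap.add_apply, ht, ht']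
    | smul_tprod c' y => simp only [map_smul, LinearMap.smul_apply, map₂_tprod_tprod, h, smul_comm c]

theorem map₂_assoc {E₁ E₂ E₃ E₁₂ E₂₃ F : Type*} [AddCommGroup E₁] [Module k E₁]
    [AddCommGroup E₂] [Module k E₂] [AddCommGroup E₃] [Module k E₃] [AddCommGroup E₁₂]
    [Module k E₁₂] [AddCommGroup E₂₃] [Module k E₂₃] [AddCommGroup F] [Module k F]
    (B₁₂ : E₁ →ₗ[k] E₂ →ₗ[k] E₁₂) (B : E₁₂ →ₗ[k] E₃ →ₗ[k] F) (B₂₃ : E₂ →ₗ[k] E₃ →ₗ[k] E₂₃)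
    (B' : E₁ →ₗ[k] E₂₃ →ₗ[k] F) (h : ∀ x y z, B (B₁₂ x y) z = B' x (B₂₃ y z))
    (r : ⨂[k] _ : Fin d, E₁) (s : ⨂[k] _ : Fin d, E₂) (t : ⨂[k] _ : Fin d, E₃) :
    PiTensorProduct.map₂ (fun _ : Fin d => B)
        (PiTensorProduct.map₂ (fun _ : Fin d => B₁₂) r s) t =
      PiTensorProduct.map₂ (fun _ : Fin d => B') r
        (PiTensorProduct.map₂ (fun _ : Fin d => B₂₃) s t) := by
  induction r using PiTensorProduct.induction_on with
  | add r r' hr hr' => simp only [map_add, LinearMap.add_apply, hr, hr']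
  | smul_tprod c x =>
    induction s using PiTensorProduct.induction_on with
    | add s s' hs hs' => simp only [map_add, LinearMap.add_apply, hs, hs']
    | smul_tprod c' y =>
      induction t using PiTensorProduct.induction_on with
      | add t t' ht ht' => simp only [map_add, ht, ht']
      | smul_tprod c'' z =>
        simp only [map_smul, LinearMap.smul_apply, map₂_tprod_tprod, h]

theorem tprod_mem_divPow (e : E) : (tprod k fun _ : Fin d => e) ∈ divPow k d E :=
  fun σ => reindex_tprod σ _

theorem tprod_mem_tensorDeg_zero {N : ℤ → Submodule k E} {e : E} (he : e ∈ N 0) :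
    (tprod k fun _ : Fin d => e) ∈ tensorDeg d N 0 :=
  Submodule.subset_span ⟨fun _ => 0, fun _ => e, fun _ => he, by simp, rfl⟩

end

/-- For a `k`-linear category `C`, the category `Γ^d C` has the same objects, and
`Hom_{Γ^d C}(X, Y) = Γ^d(Hom_C(X, Y))` with the componentwise composition. -/
structure DivPowCat (k : Type u) (d : ℕ) (C : Type w) where
  /-- an object of `C` as an object of `Γ^d C` -/
  of ::
  /-- the underlying object of `C` -/
  obj : C

variable (k : Type u) [Field k] (d : ℕ) (C : Type w) [Category.{v} C] [Preadditive C] [Linear k C]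

instance : Category.{max u v} (DivPowCat k d C) where
  Hom X Y := divPow k d (X.obj ⟶ Y.obj)
  id X := ⟨tprod k fun _ => 𝟙 X.obj, tprod_mem_divPow _⟩
  comp {X Y Z} f g := ⟨PiTensorProduct.map₂ (fun _ => Linear.comp X.obj Y.obj Z.obj) f.1 g.1,
    map₂_mem_divPow _ f.2 g.2⟩
  id_comp f := Subtype.ext (map₂_unit_left _ _ (fun x => Category.id_comp x) f.1)
  comp_id f := Subtype.ext (map₂_unit_right _ _ (fun x => Category.comp_id x) f.1)
  assoc f g h := Subtype.ext
    (map₂_assoc _ _ _ _ (fun x y z => Category.assoc x y z) f.1 g.1 h.1)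

instance : Preadditive (DivPowCat k d C) where
  homGroup X Y := inferInstanceAs (AddCommGroup (divPow k d (X.obj ⟶ Y.obj)))
  add_comp X Y Z f f' g := Subtype.ext (LinearMap.map_add₂
    (PiTensorProduct.map₂ fun _ : Fin d => Linear.comp X.obj Y.obj Z.obj) f.1 f'.1 g.1)
  comp_add X Y Z f g g' := Subtype.ext (map_add
    (PiTensorProduct.map₂ (fun _ : Fin d => Linear.comp X.obj Y.obj Z.obj) f.1) g.1 g'.1)

instance : Linear k (DivPowCat k d C) where
  homModule X Y := inferInstanceAs (Module k (divPow k d (X.obj ⟶ Y.obj)))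
  smul_comp X Y Z r f g := Subtype.ext (LinearMap.map_smul₂
    (PiTensorProduct.map₂ fun _ : Fin d => Linear.comp X.obj Y.obj Z.obj) r f.1 g.1)
  comp_smul X Y Z f r g := Subtype.ext (map_smul
    (PiTensorProduct.map₂ (fun _ : Fin d => Linear.comp X.obj Y.obj Z.obj) f.1) r g.1)

instance [GradedCategory k C] : GradedCategory k (DivPowCat k d C) where
  deg X Y := divPowDeg d (GradedCategory.deg X.obj Y.obj)
  isInternal _ _ := divPowDeg_isInternal _ (GradedCategory.isInternal _ _)
  id_mem X := tprod_mem_tensorDeg_zero (GradedCategory.id_mem X.obj)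
  comp_mem {X Y Z _ _ _ _} hf hg :=
    map₂_mem_tensorDeg (Linear.comp X.obj Y.obj Z.obj)
      (N := GradedCategory.deg (k := k) X.obj Y.obj)
      (N' := GradedCategory.deg (k := k) Y.obj Z.obj)
      (N'' := GradedCategory.deg (k := k) X.obj Z.obj)
      (fun _ _ _ _ hx hy => GradedCategory.comp_mem hx hy) hf hg

end DividedPowers

section TruncatedPolynomials

/-- The algebra `A = k[x]/(x^p)`. -/
abbrev TruncPoly (k : Type u) [Field k] (p : ℕ) : Type u :=
  AdjoinRoot (Polynomial.X ^ p : Polynomial k)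

variable (k : Type u) [Field k] (p : ℕ)

/-- The grading of `A = k[x]/(x^p)` with `x` in degree `2`. -/
noncomputable def truncDeg (m : ℤ) : Submodule k (TruncPoly k p) :=
  Submodule.span k {a | ∃ i : ℕ, 2 * (i : ℤ) = m ∧
    a = AdjoinRoot.root (Polynomial.X ^ p : Polynomial k) ^ i}

theorem one_mem_truncDeg : 1 ∈ truncDeg k p 0 :=
  Submodule.subset_span ⟨0, by simp, by simp⟩

variable {k p} in
theorem mul_mem_truncDeg {i j : ℤ} {a b : TruncPoly k p} (ha : a ∈ truncDeg k p i)
    (hb : b ∈ truncDeg k p j) : a * b ∈ truncDeg k p (i + j) := by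
  have h := Submodule.mul_mem_mul ha hb
  rw [truncDeg, truncDeg, Submodule.span_mul_span] at h
  refine Submodule.span_mono ?_ h
  rintro _ ⟨_, ⟨m, rfl, rfl⟩, _, ⟨n, rfl, rfl⟩, rfl⟩
  exact ⟨m + n, by push_cast; ring, (pow_add _ _ _).symm⟩

/-- The basis `1, x, …, x^{p-1}` spans the grading. -/
theorem exists_truncPoly_basis : ∃ (n : ℕ) (b : Module.Basis (Fin n) k (TruncPoly k p)),
    ∀ m, truncDeg k p m = Submodule.span k (b '' {i | 2 * ((i : ℕ) : ℤ) = m}) := by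
  have hmon : (Polynomial.X ^ p : Polynomial k).Monic := Polynomial.monic_X_pow p
  let P := AdjoinRoot.powerBasis' hmon
  have hdim : P.dim = p := by simp [P]
  have hroot : AdjoinRoot.root (Polynomial.X ^ p : Polynomial k) ^ p = 0 := by
    have := AdjoinRoot.mk_self (f := (Polynomial.X ^ p : Polynomial k))
    rwa [map_pow, AdjoinRoot.mk_X] at this
  have hb : ∀ i, P.basis i = AdjoinRoot.root (Polynomial.X ^ p : Polynomial k) ^ (i : ℕ) :=
    fun i => by rw [P.basis_eq_pow]; simp [P]
  refine ⟨P.dim, P.basis, fun m => le_antisymm ?_ ?_⟩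
  · refine Submodule.span_le.mpr ?_
    rintro _ ⟨i, rfl, rfl⟩
    by_cases hi : i < P.dim
    · exact Submodule.subset_span ⟨⟨i, hi⟩, rfl, hb _⟩
    · rw [pow_eq_zero_of_le (by omega) hroot]
      exact Submodule.zero_mem _
  · refine Submodule.span_mono ?_
    rintro _ ⟨i, rfl, rfl⟩
    exact ⟨i, rfl, hb i⟩

/-- The grading of `H ⊗ A` for a vector space `H` in degree `0`. -/
noncomputable def tensorTruncDeg (H : Type v) [AddCommGroup H] [Module k H] (m : ℤ) :
    Submodule k (H ⊗[k] TruncPoly k p) :=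
  Submodule.span k {t | ∃ (h : H) (a : TruncPoly k p), a ∈ truncDeg k p m ∧ t = h ⊗ₜ a}

theorem tensorTruncDeg_isInternal (H : Type v) [AddCommGroup H] [Module k H] :
    DirectSum.IsInternal (tensorTruncDeg k p H) := by
  obtain ⟨n, b, hb⟩ := exists_truncPoly_basis k p
  let c := Module.Basis.ofVectorSpace k H
  refine isInternal_of_basis (c.tensorProduct b) (fun q => 2 * ((q.2 : ℕ) : ℤ)) _
    fun m => le_antisymm ?_ ?_
  · refine Submodule.span_le.mpr ?_
    rintro _ ⟨h, a, ha, rfl⟩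
    rw [hb, Module.Basis.mem_span_image] at ha
    rw [SetLike.mem_coe, Module.Basis.mem_span_image]
    intro q hq
    refine ha (Finsupp.mem_support_iff.mpr fun h0 => ?_)
    refine Finsupp.mem_support_iff.mp hq ?_
    rw [Module.Basis.tensorProduct_repr_tmul_apply, h0]
    simp
  · refine Submodule.span_le.mpr ?_
    rintro _ ⟨q, rfl, rfl⟩
    refine Submodule.subset_span ⟨c q.1, b q.2, ?_, Module.Basis.tensorProduct_apply' c b q⟩
    rw [hb]
    exact Submodule.subset_span ⟨q.2, rfl, rfl⟩

/-- An object `V ⊗ A` of the category `V_A`, labelled by the finite dimensional space `V`. -/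
structure FreeModCat (k : Type u) [Field k] (p : ℕ) where
  /-- the free module `V ⊗ A` on the finite dimensional space `V` -/
  of ::
  /-- the finite dimensional space `V` -/
  space : FGModuleCat.{u} k

variable {k p}

variable (p) in
/-- The composition `Hom(U, V) ⊗ A × Hom(V, W) ⊗ A → Hom(U, W) ⊗ A`,
`(f ⊗ a, g ⊗ b) ↦ (g ∘ f) ⊗ a b`. -/
noncomputable def homTensorComp (U V W : Type u) [AddCommGroup U] [Module k U] [AddCommGroup V]
    [Module k V] [AddCommGroup W] [Module k W] :
    ((U →ₗ[k] V) ⊗[k] TruncPoly k p) →ₗ[k] ((V →ₗ[k] W) ⊗[k] TruncPoly k p) →ₗ[k]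
      ((U →ₗ[k] W) ⊗[k] TruncPoly k p) :=
  TensorProduct.map₂ (LinearMap.llcomp k U V W).flip (LinearMap.mul k (TruncPoly k p))

theorem homTensorComp_tmul {U V W : Type u} [AddCommGroup U] [Module k U] [AddCommGroup V]
    [Module k V] [AddCommGroup W] [Module k W] (f : U →ₗ[k] V) (g : V →ₗ[k] W)
    (a b : TruncPoly k p) :
    homTensorComp p U V W (f ⊗ₜ a) (g ⊗ₜ b) = (g ∘ₗ f) ⊗ₜ (a * b) := rfl

/-- The graded category `V_A` of the graded modules `V ⊗ A`, with
`Hom_{V_A}(V ⊗ A, W ⊗ A) = Hom_A(V ⊗ A, W ⊗ A) = Hom(V, W) ⊗ A`. -/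
noncomputable instance : Category.{u} (FreeModCat k p) where
  Hom V W := (V.space →ₗ[k] W.space) ⊗[k] TruncPoly k p
  id V := LinearMap.id ⊗ₜ 1
  comp {U V W} f g := homTensorComp p U.space V.space W.space f g
  id_comp f := by
    induction f with
    | zero => exact map_zero _
    | add x y hx hy => exact (map_add _ x y).trans (congrArg₂ _ hx hy)
    | tmul f a => simp [homTensorComp_tmul]
  comp_id f := by
    induction f with
    | zero => exact LinearMap.map_zero₂ _ _
    | add x y hx hy => exact (LinearMap.map_add₂ _ x y _).trans (congrArg₂ _ hx hy)
    | tmul f a => simp [homTensorComp_tmul]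
  assoc f g h := by
    induction f with
    | zero => simp
    | add x y hx hy => simp only [map_add, LinearMap.add_apply, hx, hy]
    | tmul f a =>
      induction g with
      | zero => simp
      | add x y hx hy => simp only [map_add, LinearMap.add_apply, hx, hy]
      | tmul g b =>
        induction h with
        | zero => simp
        | add x y hx hy => simp only [map_add, hx, hy]
        | tmul h c => simp only [homTensorComp_tmul, LinearMap.comp_assoc, mul_assoc]

noncomputable instance : Preadditive (FreeModCat k p) where
  homGroup V W := inferInstanceAs (AddCommGroup ((V.space →ₗ[k] W.space) ⊗[k] TruncPoly k p))
  add_comp U V W f f' g :=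
    (LinearMap.map_add₂ (homTensorComp p U.space V.space W.space) f f' g :)
  comp_add U V W f g g' :=
    ((homTensorComp p U.space V.space W.space f).map_add g g' :)

noncomputable instance : Linear k (FreeModCat k p) where
  homModule V W := inferInstanceAs (Module k ((V.space →ₗ[k] W.space) ⊗[k] TruncPoly k p))
  smul_comp U V W r f g :=
    (LinearMap.map_smul₂ (homTensorComp p U.space V.space W.space) r f g :)
  comp_smul U V W f r g :=
    ((homTensorComp p U.space V.space W.space f).map_smul r g :)

theorem homTensorComp_mem {U V W : Type u} [AddCommGroup U] [Module k U] [AddCommGroup V]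
    [Module k V] [AddCommGroup W] [Module k W] {i j : ℤ} {s : (U →ₗ[k] V) ⊗[k] TruncPoly k p}
    {t : (V →ₗ[k] W) ⊗[k] TruncPoly k p} (hs : s ∈ tensorTruncDeg k p (U →ₗ[k] V) i)
    (ht : t ∈ tensorTruncDeg k p (V →ₗ[k] W) j) :
    homTensorComp p U V W s t ∈ tensorTruncDeg k p (U →ₗ[k] W) (i + j) := by
  induction hs using Submodule.span_induction with
  | zero => simp
  | add x y _ _ hx hy => rw [LinearMap.map_add₂]; exact Submodule.add_mem _ hx hy
  | smul a x _ hx => rw [LinearMap.map_smul₂]; exact Submodule.smul_mem _ a hx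
  | mem x hx =>
    obtain ⟨f, a, ha, rfl⟩ := hx
    induction ht using Submodule.span_induction with
    | zero => simp
    | add x y _ _ hx hy => rw [map_add]; exact Submodule.add_mem _ hx hy
    | smul a x _ hx => rw [map_smul]; exact Submodule.smul_mem _ a hx
    | mem y hy =>
      obtain ⟨g, b, hb, rfl⟩ := hy
      rw [homTensorComp_tmul]
      exact Submodule.subset_span ⟨g ∘ₗ f, a * b, mul_mem_truncDeg ha hb, rfl⟩

noncomputable instance : GradedCategory k (FreeModCat k p) where
  deg V W := tensorTruncDeg k p (V.space →ₗ[k] W.space)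
  isInternal _ _ := tensorTruncDeg_isInternal k p _
  id_mem _ := Submodule.subset_span ⟨LinearMap.id, 1, one_mem_truncDeg k p, rfl⟩
  comp_mem hf hg := homTensorComp_mem hf hg

end TruncatedPolynomials

section GradedModules

/-- An object of `V^{f+}`: a `ℤ`-graded `k`-vector space, bounded below and finite dimensional in
each degree. -/
structure GrVect (k : Type u) [Field k] where
  /-- the underlying vector space -/
  carrier : Type u
  [addCommGroup : AddCommGroup carrier]
  [module : Module k carrier]
  /-- the homogeneous parts -/
  gr : ℤ → Submodule k carrier
  isInternal : DirectSum.IsInternal gr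
  finite (i : ℤ) : Module.Finite k (gr i)
  bddBelow : ∃ m : ℤ, ∀ i < m, gr i = ⊥

attribute [instance] GrVect.addCommGroup GrVect.module

theorem eq_of_eqOn_homogeneous {k M N : Type*} [Field k] [AddCommGroup M] [Module k M]
    [AddCommGroup N] {gr : ℤ → Submodule k M} (h : DirectSum.IsInternal gr) {f g : M →+ N}
    (hfg : ∀ i, ∀ x ∈ gr i, f x = g x) : f = g := by
  ext x
  have hx : x ∈ ⨆ i, gr i := by rw [h.submodule_iSup_eq_top]; trivial
  induction hx using Submodule.iSup_induction' with
  | mem i x hx => exact hfg i x hx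
  | zero => simp
  | add x y _ _ hx hy => rw [map_add, map_add, hx, hy]

/-- Independence of the spaces of homogeneous maps. -/
theorem sum_homogeneous_eq_zero {k M N : Type*} [Field k] [AddCommGroup M] [Module k M]
    [AddCommGroup N] [Module k N] {gr : ℤ → Submodule k M} (h : DirectSum.IsInternal gr)
    {gr' : ℤ → Submodule k N} (h' : DirectSum.IsInternal gr') (s : Finset ℤ) (v : ℤ → M →+ N)
    (hv : ∀ j ∈ s, ∀ i, ∀ x ∈ gr i, v j x ∈ gr' (i + j)) (hs : ∑ j ∈ s, v j = 0) :
    ∀ j ∈ s, v j = 0 := by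
  intro j hj
  refine eq_of_eqOn_homogeneous h fun i x hx => ?_
  have h1 := h'.submodule_iSupIndep.comp (add_right_injective i)
  rw [iSupIndep_iff_finsetSum_eq_zero_imp_eq_zero] at h1
  refine h1 s (fun j => v j x) (fun j hj => hv j hj i x hx) ?_ j hj
  have := DFunLike.congr_fun hs x
  simpa using this

namespace GrVect

variable {k : Type u} [Field k]

/-- The linear maps of degree `j`. -/
def mapDeg (M N : GrVect k) (j : ℤ) : Submodule k (M.carrier →ₗ[k] N.carrier) where
  carrier := {f | ∀ i, ∀ x ∈ M.gr i, f x ∈ N.gr (i + j)}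
  add_mem' hf hg i x hx := Submodule.add_mem _ (hf i x hx) (hg i x hx)
  zero_mem' _ _ _ := Submodule.zero_mem _
  smul_mem' c _ hf i x hx := Submodule.smul_mem _ c (hf i x hx)

theorem mapDeg_indep (M N : GrVect k) : iSupIndep (mapDeg M N) := by
  rw [iSupIndep_iff_finsetSum_eq_zero_imp_eq_zero]
  intro s v hv hs j hj
  have h := sum_homogeneous_eq_zero M.isInternal N.isInternal s
    (fun j => (v j).toAddMonoidHom) hv ?_ j hj
  · exact LinearMap.toAddMonoidHom_injective h
  · ext x
    simpa using DFunLike.congr_fun hs x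

theorem comp_mem_mapDeg {M N P : GrVect k} {i j : ℤ} {f : M.carrier →ₗ[k] N.carrier}
    {g : N.carrier →ₗ[k] P.carrier} (hf : f ∈ mapDeg M N i) (hg : g ∈ mapDeg N P j) :
    g ∘ₗ f ∈ mapDeg M P (i + j) := fun l x hx => by
  rw [← add_assoc]
  exact hg _ _ (hf l x hx)

/-- The morphisms of `V^{f+}` are the finite sums of homogeneous linear maps. -/
def homs (M N : GrVect k) : Submodule k (M.carrier →ₗ[k] N.carrier) := ⨆ j, mapDeg M N j

theorem id_mem_mapDeg (M : GrVect k) : LinearMap.id ∈ mapDeg M M 0 :=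
  fun i x hx => by simpa using hx

instance : Category.{u} (GrVect k) where
  Hom M N := homs M N
  id M := ⟨LinearMap.id, Submodule.mem_iSup_of_mem 0 (id_mem_mapDeg M)⟩
  comp f g := ⟨g.1 ∘ₗ f.1, iSup_mem_of_bilin (LinearMap.llcomp k _ _ _).flip _ _ _
    (fun _ _ _ _ hf hg => comp_mem_mapDeg hf hg) f.2 g.2⟩

instance : Preadditive (GrVect k) where
  homGroup M N := inferInstanceAs (AddCommGroup (homs M N))
  add_comp _ _ _ f f' g := Subtype.ext (LinearMap.comp_add f.1 f'.1 g.1)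
  comp_add _ _ _ f g g' := Subtype.ext (LinearMap.add_comp f.1 g'.1 g.1)

instance : Linear k (GrVect k) where
  homModule M N := inferInstanceAs (Module k (homs M N))
  smul_comp _ _ _ r f g := Subtype.ext (LinearMap.comp_smul g.1 r f.1)
  comp_smul _ _ _ f r g := Subtype.ext (LinearMap.smul_comp r g.1 f.1)

instance : GradedCategory k (GrVect k) where
  deg M N j := (mapDeg M N j).comap (homs M N).subtype
  isInternal M N := isInternal_iSup _ (mapDeg_indep M N)
  id_mem M := id_mem_mapDeg M
  comp_mem hf hg := comp_mem_mapDeg hf hg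

end GrVect

/-- A graded left module over the graded `k`-algebra `S = ⨁ 𝒮 i`, bounded below and finite
dimensional over `k` in each degree. -/
structure GrMod (k : Type u) [Field k] {S : Type u} [Ring S] [Algebra k S]
    (𝒮 : ℤ → Submodule k S) [GradedAlgebra 𝒮] extends GrVect k where
  [moduleAlg : Module S carrier]
  [isScalarTower : IsScalarTower k S carrier]
  smul_mem {i j : ℤ} {s : S} {x : carrier} (hs : s ∈ 𝒮 i) (hx : x ∈ gr j) : s • x ∈ gr (i + j)

attribute [instance] GrMod.moduleAlg GrMod.isScalarTower

namespace GrMod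

variable {k : Type u} [Field k] {S : Type u} [Ring S] [Algebra k S] {𝒮 : ℤ → Submodule k S}
  [GradedAlgebra 𝒮]

instance (M : GrMod k 𝒮) : SMulCommClass S k M.carrier := IsScalarTower.to_smulCommClass'

/-- The `S`-linear maps of degree `j`. -/
def mapDeg (M N : GrMod k 𝒮) (j : ℤ) : Submodule k (M.carrier →ₗ[S] N.carrier) where
  carrier := {f | ∀ i, ∀ x ∈ M.gr i, f x ∈ N.gr (i + j)}
  add_mem' hf hg i x hx := Submodule.add_mem _ (hf i x hx) (hg i x hx)
  zero_mem' _ _ _ := Submodule.zero_mem _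
  smul_mem' c _ hf i x hx := Submodule.smul_mem _ c (hf i x hx)

theorem mapDeg_indep (M N : GrMod k 𝒮) : iSupIndep (mapDeg M N) := by
  rw [iSupIndep_iff_finsetSum_eq_zero_imp_eq_zero]
  intro s v hv hs j hj
  have h := sum_homogeneous_eq_zero M.isInternal N.isInternal s
    (fun j => (v j).toAddMonoidHom) hv ?_ j hj
  · exact LinearMap.toAddMonoidHom_injective h
  · ext x
    simpa using DFunLike.congr_fun hs x

theorem comp_mem_mapDeg {M N P : GrMod k 𝒮} {i j : ℤ} {f : M.carrier →ₗ[S] N.carrier}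
    {g : N.carrier →ₗ[S] P.carrier} (hf : f ∈ mapDeg M N i) (hg : g ∈ mapDeg N P j) :
    g ∘ₗ f ∈ mapDeg M P (i + j) := fun l x hx => by
  rw [← add_assoc]
  exact hg _ _ (hf l x hx)

/-- The morphisms of graded modules are the finite sums of homogeneous `S`-linear maps. -/
def homs (M N : GrMod k 𝒮) : Submodule k (M.carrier →ₗ[S] N.carrier) := ⨆ j, mapDeg M N j

theorem id_mem_mapDeg (M : GrMod k 𝒮) : LinearMap.id ∈ mapDeg M M 0 :=
  fun i x hx => by simpa using hx

/-- Composition of `S`-linear maps as a `k`-bilinear map. -/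
def compBilin (M N P : GrMod k 𝒮) : (M.carrier →ₗ[S] N.carrier) →ₗ[k]
    (N.carrier →ₗ[S] P.carrier) →ₗ[k] (M.carrier →ₗ[S] P.carrier) :=
  LinearMap.mk₂ k (fun f g => g ∘ₗ f) (fun f f' g => LinearMap.comp_add f f' g)
    (fun c f g => by ext x; exact (g.restrictScalars k).map_smul c (f x))
    (fun f g g' => LinearMap.add_comp f g' g) (fun c f g => LinearMap.smul_comp c g f)

instance : Category.{u} (GrMod k 𝒮) where
  Hom M N := homs M N
  id M := ⟨LinearMap.id, Submodule.mem_iSup_of_mem 0 (id_mem_mapDeg M)⟩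
  comp f g := ⟨g.1 ∘ₗ f.1, iSup_mem_of_bilin (compBilin _ _ _) _ _ _
    (fun _ _ _ _ hf hg => comp_mem_mapDeg hf hg) f.2 g.2⟩

instance : Preadditive (GrMod k 𝒮) where
  homGroup M N := inferInstanceAs (AddCommGroup (homs M N))
  add_comp _ _ _ f f' g := Subtype.ext (LinearMap.comp_add f.1 f'.1 g.1)
  comp_add _ _ _ f g g' := Subtype.ext (LinearMap.add_comp f.1 g'.1 g.1)

instance : Linear k (GrMod k 𝒮) where
  homModule M N := inferInstanceAs (Module k (homs M N))
  smul_comp M N P r f g := Subtype.ext (LinearMap.map_smul₂ (compBilin M N P) r f.1 g.1)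
  comp_smul _ _ _ f r g := Subtype.ext (LinearMap.smul_comp r g.1 f.1)

instance : GradedCategory k (GrMod k 𝒮) where
  deg M N j := (mapDeg M N j).comap (homs M N).subtype
  isInternal M N := isInternal_iSup _ (mapDeg_indep M N)
  id_mem M := id_mem_mapDeg M
  comp_mem hf hg := comp_mem_mapDeg hf hg

end GrMod

end GradedModules

section SchurAlgebra

open PiTensorProduct

section

variable (k : Type u) [Field k] (d : ℕ) (B : Type u) [Ring B] [Algebra k B]

theorem mul_eq_map₂ (s t : ⨂[k] _ : Fin d, B) :
    s * t = PiTensorProduct.map₂ (fun _ => LinearMap.mul k B) s t := by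
  induction s using PiTensorProduct.induction_on with
  | add s s' hs hs' => rw [add_mul, map_add, LinearMap.add_apply, hs, hs']
  | smul_tprod c x =>
    induction t using PiTensorProduct.induction_on with
    | add t t' ht ht' => rw [mul_add, map_add, ht, ht']
    | smul_tprod c' y =>
      rw [smul_mul_smul_comm, tprod_mul_tprod, map_smul, LinearMap.map_smul₂, map₂_tprod_tprod,
        smul_smul, mul_comm]
      rfl

/-- The algebra `Γ^d(B)` of symmetric tensors on an algebra `B`, a subalgebra of `B^{⊗ d}`. -/
def divPowAlg : Subalgebra k (⨂[k] _ : Fin d, B) where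
  carrier := divPow k d B
  mul_mem' ha hb := by
    rw [mul_eq_map₂]
    exact map₂_mem_divPow _ ha hb
  add_mem' ha hb := (divPow k d B).add_mem ha hb
  algebraMap_mem' r := by
    rw [Algebra.algebraMap_eq_smul_one]
    exact (divPow k d B).smul_mem r (tprod_mem_divPow (1 : B))

variable {k B} in
/-- The grading of `Γ^d(B)` induced by a grading of `B`. -/
def divPowAlgDeg (N : ℤ → Submodule k B) (m : ℤ) : Submodule k (divPowAlg k d B) :=
  (tensorDeg d N m).comap (divPowAlg k d B).val.toLinearMap

variable {k B} in
theorem divPowAlgDeg_isInternal (N : ℤ → Submodule k B) (hN : DirectSum.IsInternal N) :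
    DirectSum.IsInternal (divPowAlgDeg d N) :=
  divPowDeg_isInternal N hN

end

variable (k : Type u) [Field k] (p d n : ℕ)

/-- The affine Schur algebra `S_{d,n}^{af} = Γ^d(End(k^n) ⊗ A)`. -/
abbrev AffSchur : Type u := divPowAlg k d (Module.End k (Fin n → k) ⊗[k] TruncPoly k p)

/-- The grading of the affine Schur algebra, induced by that of `A`. -/
noncomputable def affSchurDeg : ℤ → Submodule k (AffSchur k p d n) :=
  divPowAlgDeg d (tensorTruncDeg k p (Module.End k (Fin n → k)))

theorem affSchurDeg_isInternal : DirectSum.IsInternal (affSchurDeg k p d n) :=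
  divPowAlgDeg_isInternal d _ (tensorTruncDeg_isInternal k p (Module.End k (Fin n → k)))

/-- The object `A^n = k^n ⊗ A` of `Γ^d V_A`. -/
noncomputable abbrev freeObj : DivPowCat k d (FreeModCat k p) := .of (.of (FGModuleCat.of k (Fin n → k)))

variable {k p d n}

/-- An element of the affine Schur algebra as an endomorphism of `A^n` in `Γ^d V_A`. -/
def AffSchur.toHom (s : AffSchur k p d n) : freeObj k p d n ⟶ freeObj k p d n := ⟨s.1, s.2⟩

theorem AffSchur.toHom_one : (1 : AffSchur k p d n).toHom = 𝟙 _ := rfl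

theorem AffSchur.toHom_add (s t : AffSchur k p d n) : (s + t).toHom = s.toHom + t.toHom := rfl

theorem AffSchur.toHom_zero : (0 : AffSchur k p d n).toHom = 0 := rfl

theorem AffSchur.toHom_smul (c : k) (s : AffSchur k p d n) : (c • s).toHom = c • s.toHom := rfl

theorem mul_eq_homTensorComp (x y : Module.End k (Fin n → k) ⊗[k] TruncPoly k p) :
    LinearMap.mul k _ x y = homTensorComp p (Fin n → k) (Fin n → k) (Fin n → k) y x := by
  rw [LinearMap.mul_apply']
  induction x with
  | zero => rw [zero_mul, map_zero]
  | add x x' hx hx' => rw [add_mul, map_add, hx, hx']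
  | tmul f a =>
    induction y with
    | zero => rw [mul_zero, map_zero]; rfl
    | add y y' hy hy' => rw [mul_add, map_add, LinearMap.add_apply, hy, hy']
    | tmul g b =>
      rw [Algebra.TensorProduct.tmul_mul_tmul, mul_comm a b]
      exact (homTensorComp_tmul g f b a).symm

theorem AffSchur.toHom_mul (s t : AffSchur k p d n) : (s * t).toHom = t.toHom ≫ s.toHom := by
  have h := map₂_swap (LinearMap.mul k (Module.End k (Fin n → k) ⊗[k] TruncPoly k p))
    (homTensorComp p (Fin n → k) (Fin n → k) (Fin n → k)) mul_eq_homTensorComp s.1 t.1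
  exact Subtype.ext ((mul_eq_map₂ k d _ s.1 t.1).trans h)

theorem AffSchur.toHom_mem {s : AffSchur k p d n} {i : ℤ} (hs : s ∈ affSchurDeg k p d n i) :
    s.toHom ∈ GradedCategory.deg (k := k) (freeObj k p d n) (freeObj k p d n) i := hs

noncomputable instance : GradedAlgebra (affSchurDeg k p d n) where
  one_mem := GradedCategory.id_mem (k := k) (freeObj k p d n)
  mul_mem {i j s t} hs ht := by
    have h := GradedCategory.comp_mem (AffSchur.toHom_mem ht) (AffSchur.toHom_mem hs)
    rw [← AffSchur.toHom_mul, add_comm] at h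
    exact h
  __ := (affSchurDeg_isInternal k p d n).chooseDecomposition

variable (k p d) in
/-- The category `P_d^{af}` of affine strict polynomial functors homogeneous of degree `d`: the
graded `k`-linear functors `Γ^d V_A ⥤ V^{f+}`. -/
abbrev AffPoly := GradedFunctor k (DivPowCat k d (FreeModCat k p)) (GrVect k)

namespace AffPoly

variable (n) in
/-- The space `F(A^n)`. -/
noncomputable abbrev evalVect (F : AffPoly k p d) : GrVect k := F.toFunctor.obj (freeObj k p d n)

variable (n) in
/-- The action of `S_{d,n}^{af}` on `F(A^n)` through the functor `F`. -/
@[reducible] noncomputable def evalModule (F : AffPoly k p d) : Module (AffSchur k p d n) (F.evalVect n).carrier where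
  smul s x := (F.toFunctor.map s.toHom).1 x
  one_smul x := by
    change (F.toFunctor.map (𝟙 _)).1 x = x
    rw [F.toFunctor.map_id]; rfl
  mul_smul s t x := by
    change (F.toFunctor.map (s * t).toHom).1 x = _
    rw [AffSchur.toHom_mul, F.toFunctor.map_comp]; rfl
  smul_zero s := map_zero _
  smul_add s x y := map_add _ x y
  add_smul s t x := by
    change (F.toFunctor.map (s + t).toHom).1 x = _
    rw [AffSchur.toHom_add, F.toFunctor.map_add]; rfl
  zero_smul x := by
    change (F.toFunctor.map (0 : AffSchur k p d n).toHom).1 x = _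
    rw [AffSchur.toHom_zero, F.toFunctor.map_zero]; rfl

variable (n) in
/-- `F(A^n)` as a graded module over the affine Schur algebra. -/
noncomputable def evalObj (F : AffPoly k p d) : GrMod k (affSchurDeg k p d n) where
  toGrVect := F.evalVect n
  moduleAlg := F.evalModule n
  isScalarTower :=
    letI := F.evalModule n
    ⟨fun c s x => by
      change (F.toFunctor.map (c • s).toHom).1 x = c • (F.toFunctor.map s.toHom).1 x
      rw [AffSchur.toHom_smul, F.toFunctor.map_smul]; rfl⟩
  smul_mem {i j s x} hs hx := by
    rw [add_comm]
    exact F.map_mem (AffSchur.toHom_mem hs) j x hx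

/-- The component at `A^n` of a natural transformation, as an `S_{d,n}^{af}`-linear map. -/
noncomputable def evalMap {F G : AffPoly k p d} (η : F.toFunctor ⟶ G.toFunctor) :
    (F.evalObj n).carrier →ₗ[AffSchur k p d n] (G.evalObj n).carrier where
  toFun := (η.app (freeObj k p d n)).1
  map_add' := map_add _
  map_smul' s x := by
    have h := congrArg Subtype.val (η.naturality s.toHom)
    exact DFunLike.congr_fun h x

theorem evalMap_mem {F G : AffPoly k p d} {j : ℤ} {η : F.toFunctor ⟶ G.toFunctor}
    (hη : η ∈ GradedFunctor.natDeg F G j) :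
    evalMap η ∈ GrMod.mapDeg (F.evalObj n) (G.evalObj n) j := hη (freeObj k p d n)

theorem evalMap_mem_homs {F G : AffPoly k p d} {η : F.toFunctor ⟶ G.toFunctor}
    (hη : η ∈ GradedFunctor.homs F G) :
    evalMap η ∈ GrMod.homs (F.evalObj n) (G.evalObj n) := by
  refine Submodule.iSup_induction (GradedFunctor.natDeg F G)
    (motive := fun η => evalMap η ∈ GrMod.homs (F.evalObj n) (G.evalObj n)) hη ?_ ?_ ?_
  · exact fun j η hη => Submodule.mem_iSup_of_mem j (evalMap_mem hη)
  · exact Submodule.zero_mem _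
  · exact fun η θ hη hθ => Submodule.add_mem _ hη hθ

variable (k p d n) in
/-- The evaluation functor `ev_n`, `F ↦ F(A^n)`. -/
noncomputable def ev : GradedFunctor k (AffPoly k p d) (GrMod k (affSchurDeg k p d n)) where
  toFunctor :=
    { obj := fun F => F.evalObj n
      map := fun η => ⟨evalMap η.1, evalMap_mem_homs η.2⟩
      map_id := fun _ => rfl
      map_comp := fun _ _ => rfl }
  additive := ⟨rfl⟩
  linear := ⟨fun _ _ => rfl⟩
  map_mem hf := evalMap_mem hf

end AffPoly

end SchurAlgebra

end AffineSPF

namespace AffineSPF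

/-! ### Generalities on graded categories -/

section GradedCategoryLemmas

open Limits

variable {k : Type u} [Field k]
  {C : Type w} [Category.{v} C] [Preadditive C] [Linear k C] [GradedCategory k C]
  {D : Type w'} [Category.{v'} D] [Preadditive D] [Linear k D] [GradedCategory k D]

namespace GradedCategory

/-! The argument is graded Morita theory. Write `E` for `A^n` and `S` for its endomorphism algebra.
Suppose that the identity of every object `V` is a finite sum of composites `V → E → V` of morphisms
of degree 0. Then a graded functor `F` is recovered from the `S`-module `F(E)`: the map `F(V) →
Hom_S(Hom(V, E), F(E))`, `x ↦ (f ↦ F(f) x)`, is bijective (`coindUnit_bijective`). Conversely, for a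
graded module `M`, the space `Hom_S(Hom(V, E), M)` is a graded retract of a finite power of `M`
(`Factorization.lift_eval`). It is therefore again graded, bounded below and finite-dimensional in
each degree. So `M ↦ Hom_S(Hom(-, E), M)` is a quasi-inverse of evaluation; at `V = E` it gives back
`M` by evaluating at the identity. This is `evalAt_isEquivalence`.

The condition `d ≤ n` enters in producing the decompositions. A basis of `V` writes the identity as
a sum of rank one projections `e i`, so its `d`-th tensor power is the sum of all tensors `e (f 1) ⊗
⋯ ⊗ e (f d)`. Grouping these by the set `I` of values of `f` gives symmetric tensors, with no
division by orders of permutation groups. As `I` has at most `d ≤ n` elements, the span of the basis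
vectors in `I` fits into `k^n`, and the group of `I` factors through `A^n`. This is carried by
`DivPowCat.exists_factorization` and `exists_factorization_of_card_le`.

That graded modules form a graded abelian category is checked directly, with kernels, cokernels and
products taken on underlying modules (`GrMod.isGradedAbelian`). For functors the property is
transported along the equivalence (`IsGradedAbelian.of_isEquivalence`). -/

variable (k) in
theorem hom_induction {X Y : C} {motive : (X ⟶ Y) → Prop} (f : X ⟶ Y)
    (mem : ∀ j, ∀ f ∈ deg (k := k) X Y j, motive f) (zero : motive 0)
    (add : ∀ f g, motive f → motive g → motive (f + g)) : motive f := by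
  have hf : f ∈ ⨆ j, deg (k := k) X Y j := by
    rw [(isInternal (k := k) X Y).submodule_iSup_eq_top]; trivial
  exact Submodule.iSup_induction _ (motive := motive) hf mem zero add

theorem comp_mem' {X Y Z : C} {i j l : ℤ} {f : X ⟶ Y} {g : Y ⟶ Z} (hf : f ∈ deg (k := k) X Y i)
    (hg : g ∈ deg (k := k) Y Z j) (h : i + j = l) : f ≫ g ∈ deg (k := k) X Z l :=
  h ▸ comp_mem hf hg

end GradedCategory

variable (k C) in
/-- The inclusion of the category of morphisms of degree `0`. -/
def DegZero.incl : DegZero k C ⥤ C where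
  obj X := X.obj
  map f := f.1
  map_id _ := rfl
  map_comp _ _ := rfl

namespace GradedFunctor

/-- The restriction of a graded functor to morphisms of degree `0`. -/
def degZero (F : GradedFunctor k C D) : DegZero k C ⥤ DegZero k D where
  obj X := .of (F.toFunctor.obj X.obj)
  map f := ⟨F.toFunctor.map f.1, F.map_mem f.2⟩
  map_id _ := Subtype.ext (F.toFunctor.map_id _)
  map_comp f g := Subtype.ext (F.toFunctor.map_comp f.1 g.1)

/-- The isomorphism of degree `0` between graded functors given by natural isomorphisms of
degree `0`. -/
def isoMk {F G : GradedFunctor k C D}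
    (app : ∀ X, (DegZero.of (F.toFunctor.obj X) : DegZero k D) ≅ DegZero.of (G.toFunctor.obj X))
    (naturality : ∀ {X Y : C} (f : X ⟶ Y),
      F.toFunctor.map f ≫ (app Y).hom.1 = (app X).hom.1 ≫ G.toFunctor.map f) :
    (DegZero.of F : DegZero k (GradedFunctor k C D)) ≅ DegZero.of G :=
  let e : F.toFunctor ≅ G.toFunctor :=
    NatIso.ofComponents (fun X => (DegZero.incl k D).mapIso (app X)) naturality
  have h : e.hom ∈ natDeg F G 0 := fun X => (app X).hom.2
  have h' : e.inv ∈ natDeg G F 0 := fun X => (app X).inv.2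
  { hom := ⟨⟨e.hom, Submodule.mem_iSup_of_mem 0 h⟩, h⟩
    inv := ⟨⟨e.inv, Submodule.mem_iSup_of_mem 0 h'⟩, h'⟩
    hom_inv_id := Subtype.ext (Subtype.ext e.hom_inv_id)
    inv_hom_id := Subtype.ext (Subtype.ext e.inv_hom_id) }

/-- A component of an isomorphism of degree `0` between graded functors. -/
def isoApp {F G : GradedFunctor k C D}
    (e : (DegZero.of F : DegZero k (GradedFunctor k C D)) ≅ DegZero.of G) (X : C) :
    (DegZero.of (F.toFunctor.obj X) : DegZero k D) ≅ DegZero.of (G.toFunctor.obj X) where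
  hom := ⟨e.hom.1.1.app X, e.hom.2 X⟩
  inv := ⟨e.inv.1.1.app X, e.inv.2 X⟩
  hom_inv_id := Subtype.ext
    (congrArg (fun f => NatTrans.app (Subtype.val (Subtype.val f)) X) e.hom_inv_id)
  inv_hom_id := Subtype.ext
    (congrArg (fun f => NatTrans.app (Subtype.val (Subtype.val f)) X) e.inv_hom_id)

theorem isoApp_naturality {F G : GradedFunctor k C D}
    (e : (DegZero.of F : DegZero k (GradedFunctor k C D)) ≅ DegZero.of G) {X Y : C} (f : X ⟶ Y) :
    F.toFunctor.map f ≫ (isoApp e Y).hom.1 = (isoApp e X).hom.1 ≫ G.toFunctor.map f :=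
  e.hom.1.1.naturality f

/-- A graded equivalence restricts to an equivalence of the categories of morphisms of
degree `0`. -/
theorem degZero_isEquivalence {F : GradedFunctor k C D} (hF : F.IsEquivalence) :
    F.degZero.IsEquivalence := by
  obtain ⟨G, ⟨e⟩, ⟨e'⟩⟩ := hF
  let i : F.degZero ⋙ G.degZero ≅ 𝟭 (DegZero k C) :=
    NatIso.ofComponents (fun X => isoApp e X.obj) fun f =>
      Subtype.ext (isoApp_naturality e f.1)
  let i' : G.degZero ⋙ F.degZero ≅ 𝟭 (DegZero k D) :=
    NatIso.ofComponents (fun X => isoApp e' X.obj) fun f =>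
      Subtype.ext (isoApp_naturality e' f.1)
  exact (CategoryTheory.Equivalence.mk F.degZero G.degZero i.symm i').isEquivalence_functor

end GradedFunctor

/-- An equivalence transports finite products, kernels, cokernels and normality. The addition on `A`
is the given one throughout, as the equation for `a.toPreadditive` demands. -/
theorem exists_abelian_of_equivalence {A : Type w} [Category.{v} A] [P : Preadditive A]
    {B : Type w'} [Category.{v'} B] [Abelian B] (F : A ⥤ B) [F.IsEquivalence] :
    ∃ a : Abelian A, a.toPreadditive = P := by
  have : HasFiniteProducts A :=
    ⟨fun _ => Adjunction.hasLimitsOfShape_of_equivalence F⟩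
  exact ⟨abelianOfEquivalence F, rfl⟩

/-- Being graded abelian is invariant under graded equivalence. -/
theorem IsGradedAbelian.of_isEquivalence {F : GradedFunctor k C D} (hF : F.IsEquivalence)
    (hD : IsGradedAbelian k D) : IsGradedAbelian k C := by
  have := GradedFunctor.degZero_isEquivalence hF
  obtain ⟨⟨a, -⟩, hs⟩ := hD
  refine ⟨exists_abelian_of_equivalence F.degZero, fun X j => ?_⟩
  obtain ⟨G, ⟨e⟩, -⟩ := hF
  obtain ⟨Y, s, hs, hs'⟩ := hs (F.toFunctor.obj X) j
  have eX := GradedFunctor.isoApp e X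
  -- The shift of `X` is `X ≅ G (F X) ≅ G Y`: an isomorphism of degree 0 followed by the image under
  -- `G` of one of degree `j`.
  refine ⟨G.toFunctor.obj Y, (DegZero.incl k C).mapIso eX.symm ≪≫ G.toFunctor.mapIso s, ?_, ?_⟩
  · exact GradedCategory.comp_mem' eX.inv.2 (G.map_mem hs) (zero_add j)
  · exact GradedCategory.comp_mem' (G.map_mem hs') eX.hom.2 (add_zero (-j))

end GradedCategoryLemmas

/-! ### Graded modules form a graded abelian category -/

namespace GrMod

open Limits

variable {k : Type u} [Field k] {S : Type u} [Ring S] [Algebra k S] {𝒮 : ℤ → Submodule k S}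
  [GradedAlgebra 𝒮]

/-- A linear map of degree `0` as a morphism of degree `0`. -/
def homMk {M N : GrMod k 𝒮} (f : M.carrier →ₗ[S] N.carrier)
    (hf : ∀ i, ∀ x ∈ M.gr i, f x ∈ N.gr i) :
    (DegZero.of M : DegZero k (GrMod k 𝒮)) ⟶ DegZero.of N :=
  have h : f ∈ mapDeg M N 0 := fun i x hx => by simpa using hf i x hx
  ⟨⟨f, Submodule.mem_iSup_of_mem 0 h⟩, h⟩

/-- The linear map underlying a morphism of degree `0`. -/
def homMap {M N : DegZero k (GrMod k 𝒮)} (f : M ⟶ N) : M.obj.carrier →ₗ[S] N.obj.carrier := f.1.1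

@[ext]
theorem hom_ext {M N : DegZero k (GrMod k 𝒮)} {f g : M ⟶ N} (h : ∀ x, homMap f x = homMap g x) :
    f = g := Subtype.ext (Subtype.ext (LinearMap.ext h))

theorem homMap_mem {M N : DegZero k (GrMod k 𝒮)} (f : M ⟶ N) {i : ℤ} {x : M.obj.carrier}
    (hx : x ∈ M.obj.gr i) : homMap f x ∈ N.obj.gr i := by
  have h := f.2 i x hx
  rw [add_zero] at h
  exact h

end GrMod

/-! ### Kernels, cokernels and products of graded vector spaces -/

section

variable {k M N : Type*} [Field k] [AddCommGroup M] [Module k M] [AddCommGroup N] [Module k N]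
  {gr : ℤ → Submodule k M} {gr' : ℤ → Submodule k N}

/-- A homogeneous element of the image of a map that preserves gradings has a homogeneous
preimage. -/
theorem exists_homogeneous_preimage (h : DirectSum.IsInternal gr) (h' : DirectSum.IsInternal gr')
    (f : M →ₗ[k] N) (hf : ∀ i, ∀ x ∈ gr i, f x ∈ gr' i) {i : ℤ} {x : M} (hx : f x ∈ gr' i) :
    ∃ y ∈ gr i, f y = f x := by
  have hmem : x ∈ ⨆ j, gr j := by rw [h.submodule_iSup_eq_top]; trivial
  obtain ⟨c, hc, rfl⟩ := (Submodule.mem_iSup_iff_exists_finsupp ..).mp hmem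
  refine ⟨c i, hc i, ?_⟩
  classical
  -- Two homogeneous decompositions of `f x` are compared: the sum of the `f (c j)`, and the one
  -- with `f x` alone in degree `i`. The index `i` is inserted because it may lie outside the
  -- support of `c`.
  have key := (iSupIndep_iff_finsetSum_eq_imp_eq gr').mp h'.submodule_iSupIndep
    (insert i c.support) (fun j => f (c j))
    (fun j => if j = i then f (c.sum fun _ x => x) else 0) (fun j _ => ⟨hf j _ (hc j), ?_⟩) ?_ i
    (Finset.mem_insert_self _ _)
  · simpa using key
  · split_ifs with hj
    · exact hj ▸ hx
    · exact Submodule.zero_mem _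
  · rw [Finset.sum_ite_eq' (insert i c.support) i, if_pos (Finset.mem_insert_self _ _),
      Finsupp.sum, map_sum]
    refine (Finset.sum_subset (Finset.subset_insert _ _) fun j _ hj => ?_).symm
    rw [Finsupp.notMem_support_iff.mp hj, map_zero]

/-- By injectivity, `x` is the homogeneous preimage of `f x`. Hence the inverse of a bijective map
of degree 0 again has degree 0. -/
theorem mem_of_injective (h : DirectSum.IsInternal gr) (h' : DirectSum.IsInternal gr')
    (f : M →ₗ[k] N) (hf : ∀ i, ∀ x ∈ gr i, f x ∈ gr' i) (hinj : Function.Injective f)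
    {i : ℤ} {x : M} (hx : f x ∈ gr' i) : x ∈ gr i := by
  obtain ⟨y, hy, hxy⟩ := exists_homogeneous_preimage h h' f hf hx
  exact hinj hxy ▸ hy

/-- The kernel of a linear map that preserves gradings is graded. -/
theorem isInternal_ker (h : DirectSum.IsInternal gr) (h' : DirectSum.IsInternal gr')
    (f : M →ₗ[k] N) (hf : ∀ i, ∀ x ∈ gr i, f x ∈ gr' i) :
    DirectSum.IsInternal fun i => (gr i).comap (LinearMap.ker f).subtype := by
  refine isInternal_comap gr h.submodule_iSupIndep _ fun t ht => ?_
  have hmem : t ∈ ⨆ j, gr j := by rw [h.submodule_iSup_eq_top]; trivial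
  obtain ⟨c, hc, rfl⟩ := (Submodule.mem_iSup_iff_exists_finsupp ..).mp hmem
  refine ⟨c, hc, fun i => ?_, rfl⟩
  rw [LinearMap.mem_ker]
  by_cases hi : i ∈ c.support
  · rw [LinearMap.mem_ker, Finsupp.sum, map_sum] at ht
    exact (iSupIndep_iff_finsetSum_eq_zero_imp_eq_zero (p := gr')).mp h'.submodule_iSupIndep
      c.support (fun i => f (c i)) (fun i _ => hf i _ (hc i)) ht i hi
  · rw [Finsupp.notMem_support_iff.mp hi, map_zero]

/-- The cokernel of a linear map that preserves gradings is graded. -/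
theorem isInternal_map_of_exact (h : DirectSum.IsInternal gr) (h' : DirectSum.IsInternal gr')
    (f : M →ₗ[k] N) (hf : ∀ i, ∀ x ∈ gr i, f x ∈ gr' i)
    {Q : Type*} [AddCommGroup Q] [Module k Q] (q : N →ₗ[k] Q) (hq : Function.Surjective q)
    (hex : ∀ y, q y = 0 ↔ ∃ x, f x = y) :
    DirectSum.IsInternal fun i => (gr' i).map q := by
  refine DirectSum.isInternal_submodule_of_iSupIndep_of_iSup_eq_top ?_ ?_
  · rw [iSupIndep_iff_finsetSum_eq_zero_imp_eq_zero]
    intro s v hv hv0 i hi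
    -- Homogeneous lifts `y j` of a vanishing sum in the quotient add up to some `f x`. Comparing
    -- components in `N` shows that each `y i` is `f` of the degree `i` part of `x`, so it dies in
    -- the quotient.
    choose! y hy hyv using hv
    have h0 : q (∑ j ∈ s, y j) = 0 := by
      rw [map_sum, ← hv0]
      exact Finset.sum_congr rfl hyv
    obtain ⟨x, hx⟩ := (hex _).mp h0
    have hmem : x ∈ ⨆ j, gr j := by rw [h.submodule_iSup_eq_top]; trivial
    obtain ⟨c, hc, rfl⟩ := (Submodule.mem_iSup_iff_exists_finsupp ..).mp hmem
    classical
    have key := (iSupIndep_iff_finsetSum_eq_imp_eq gr').mp h'.submodule_iSupIndep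
      (s ∪ c.support) (fun j => f (c j)) (fun j => if j ∈ s then y j else 0)
      (fun j _ => ⟨hf j _ (hc j), ?_⟩) ?_ i (Finset.mem_union_left _ hi)
    · rw [if_pos hi] at key
      rw [← hyv i hi]
      exact (hex _).mpr ⟨_, key⟩
    · split_ifs with hj
      · exact hy j hj
      · exact Submodule.zero_mem _
    · rw [Finset.sum_ite_mem, Finset.union_inter_cancel_left, ← hx, Finsupp.sum, map_sum]
      refine (Finset.sum_subset Finset.subset_union_right fun j _ hj => ?_).symm
      rw [Finsupp.notMem_support_iff.mp hj, map_zero]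
  · rw [← Submodule.map_iSup, h'.submodule_iSup_eq_top, Submodule.map_top,
      LinearMap.range_eq_top.mpr hq]

theorem isInternal_prod (h : DirectSum.IsInternal gr) (h' : DirectSum.IsInternal gr') :
    DirectSum.IsInternal fun i => (gr i).prod (gr' i) := by
  refine DirectSum.isInternal_submodule_of_iSupIndep_of_iSup_eq_top ?_ ?_
  · have h1 := h.submodule_iSupIndep
    have h2 := h'.submodule_iSupIndep
    rw [iSupIndep_iff_finsetSum_eq_zero_imp_eq_zero] at h1 h2 ⊢
    intro s v hv hv0 i hi
    refine Prod.ext ?_ ?_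
    · refine h1 s (fun j => (v j).1) (fun j hj => (hv j hj).1) ?_ i hi
      rw [← Prod.fst_sum, hv0]; rfl
    · refine h2 s (fun j => (v j).2) (fun j hj => (hv j hj).2) ?_ i hi
      rw [← Prod.snd_sum, hv0]; rfl
  · rw [eq_top_iff]
    rintro ⟨x, y⟩ -
    have e1 : (⊤ : Submodule k M) ≤ (⨆ i, (gr i).prod (gr' i)).comap (LinearMap.inl k M N) := by
      rw [← h.submodule_iSup_eq_top]
      exact iSup_le fun i x hx => Submodule.mem_iSup_of_mem i ⟨hx, Submodule.zero_mem _⟩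
    have e2 : (⊤ : Submodule k N) ≤ (⨆ i, (gr i).prod (gr' i)).comap (LinearMap.inr k M N) := by
      rw [← h'.submodule_iSup_eq_top]
      exact iSup_le fun i x hx => Submodule.mem_iSup_of_mem i ⟨Submodule.zero_mem _, hx⟩
    simpa using Submodule.add_mem (⨆ i, (gr i).prod (gr' i)) (e1 (Submodule.mem_top (x := x)))
      (e2 (Submodule.mem_top (x := y)))

end

/-! ### Kernels, cokernels, products and shifts of graded modules -/

namespace GrMod

open Limits

variable {k : Type u} [Field k] {S : Type u} [Ring S] [Algebra k S] {𝒮 : ℤ → Submodule k S}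
  [GradedAlgebra 𝒮]

/-- The kernel of a morphism of degree `0`. -/
def kerObj {M N : DegZero k (GrMod k 𝒮)} (f : M ⟶ N) : GrMod k 𝒮 where
  carrier := LinearMap.ker (homMap f)
  gr i := (M.obj.gr i).comap ((LinearMap.ker (homMap f)).subtype.restrictScalars k)
  isInternal := isInternal_ker M.obj.isInternal N.obj.isInternal
    ((homMap f).restrictScalars k) fun _ _ hx => homMap_mem f hx
  finite i :=
    have := M.obj.finite i
    Module.Finite.of_injective
      (((LinearMap.ker (homMap f)).subtype.restrictScalars k).restrict (p := (M.obj.gr i).comap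
        ((LinearMap.ker (homMap f)).subtype.restrictScalars k)) (q := M.obj.gr i) fun _ hx => hx)
      fun _ _ hxy => Subtype.ext (Subtype.ext (congrArg (fun z : M.obj.gr i => (z : M.obj.carrier)) hxy))
  bddBelow := by
    obtain ⟨m, hm⟩ := M.obj.bddBelow
    refine ⟨m, fun i hi => (Submodule.eq_bot_iff _).mpr fun x hx => ?_⟩
    rw [Submodule.mem_comap, hm i hi] at hx
    exact Subtype.ext hx
  smul_mem hs hx := M.obj.smul_mem hs hx

/-- The cokernel of a morphism of degree `0`. -/
def cokerObj {M N : DegZero k (GrMod k 𝒮)} (f : M ⟶ N) : GrMod k 𝒮 where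
  carrier := N.obj.carrier ⧸ LinearMap.range (homMap f)
  gr i := (N.obj.gr i).map ((LinearMap.range (homMap f)).mkQ.restrictScalars k)
  isInternal := isInternal_map_of_exact M.obj.isInternal N.obj.isInternal
    ((homMap f).restrictScalars k) (fun _ _ hx => homMap_mem f hx)
    ((LinearMap.range (homMap f)).mkQ.restrictScalars k)
    (LinearMap.range (homMap f)).mkQ_surjective fun _ => Submodule.Quotient.mk_eq_zero _
  finite i :=
    have := N.obj.finite i
    Module.Finite.map _ _
  bddBelow := by
    obtain ⟨m, hm⟩ := N.obj.bddBelow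
    exact ⟨m, fun i hi => by rw [hm i hi, Submodule.map_bot]⟩
  smul_mem := by
    rintro i j s _ hs ⟨x, hx, rfl⟩
    exact ⟨s • x, N.obj.smul_mem hs hx, map_smul (LinearMap.range (homMap f)).mkQ s x⟩

/-- The product of two graded modules. -/
def prodObj (M N : GrMod k 𝒮) : GrMod k 𝒮 where
  carrier := M.carrier × N.carrier
  gr i := (M.gr i).prod (N.gr i)
  isInternal := isInternal_prod M.isInternal N.isInternal
  finite i :=
    Module.Finite.iff_fg.mpr
      ((Module.Finite.iff_fg.mp (M.finite i)).prod (Module.Finite.iff_fg.mp (N.finite i)))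
  bddBelow := by
    obtain ⟨m, hm⟩ := M.bddBelow
    obtain ⟨n, hn⟩ := N.bddBelow
    refine ⟨min m n, fun i hi => ?_⟩
    rw [hm i (by omega), hn i (by omega), Submodule.prod_bot]
  smul_mem hs hx := ⟨M.smul_mem hs hx.1, N.smul_mem hs hx.2⟩

/-- The zero module. -/
def zeroObj : GrMod k 𝒮 where
  carrier := PUnit
  gr _ := ⊥
  isInternal := DirectSum.isInternal_submodule_of_iSupIndep_of_iSup_eq_top
    (fun i => by simp) (Subsingleton.elim _ _)
  finite _ := inferInstance
  bddBelow := ⟨0, fun _ _ => rfl⟩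
  smul_mem _ _ := Subsingleton.elim _ _

/-- A graded module with its grading moved by `j`. -/
def shiftObj (M : GrMod k 𝒮) (j : ℤ) : GrMod k 𝒮 where
  carrier := M.carrier
  gr i := M.gr (i - j)
  isInternal := DirectSum.isInternal_submodule_of_iSupIndep_of_iSup_eq_top
    (M.isInternal.submodule_iSupIndep.comp (sub_left_injective (b := j)))
    ((Equiv.iSup_comp (Equiv.subRight j)).trans M.isInternal.submodule_iSup_eq_top)
  finite i := M.finite (i - j)
  bddBelow := by
    obtain ⟨m, hm⟩ := M.bddBelow
    exact ⟨m + j, fun i hi => hm _ (by omega)⟩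
  smul_mem {a b _ _} hs hx := by
    rw [add_sub_assoc]
    exact M.smul_mem hs hx

/-- In a preadditive category a binary bicone is a biproduct once the two idempotents it defines add
up to the identity, so this is all that is checked on `M × N`. -/
theorem hasFiniteProducts : HasFiniteProducts (DegZero k (GrMod k 𝒮)) := by
  have : HasBinaryProducts (DegZero k (GrMod k 𝒮)) := by
    have (M N : DegZero k (GrMod k 𝒮)) : HasBinaryBiproduct M N := by
      refine hasBinaryBiproduct_of_total
        { pt := .of (prodObj M.obj N.obj)
          fst := homMk (LinearMap.fst S M.obj.carrier N.obj.carrier) fun _ _ hx => hx.1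
          snd := homMk (LinearMap.snd S M.obj.carrier N.obj.carrier) fun _ _ hx => hx.2
          inl := homMk (LinearMap.inl S M.obj.carrier N.obj.carrier)
            fun _ _ hx => ⟨hx, Submodule.zero_mem _⟩
          inr := homMk (LinearMap.inr S M.obj.carrier N.obj.carrier)
            fun _ _ hx => ⟨Submodule.zero_mem _, hx⟩
          inl_fst := rfl
          inl_snd := rfl
          inr_fst := rfl
          inr_snd := rfl } ?_
      ext x
      exact Prod.ext (add_zero x.1) (zero_add x.2)
    have : HasBinaryBiproducts (DegZero k (GrMod k 𝒮)) := ⟨this⟩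
    infer_instance
  have : HasTerminal (DegZero k (GrMod k 𝒮)) :=
    (IsTerminal.ofUniqueHom (Y := .of zeroObj) (fun _ => 0)
      fun _ _ => hom_ext fun _ => Subsingleton.elim (α := PUnit) _ _).hasTerminal
  exact hasFiniteProducts_of_has_binary_and_terminal

section

variable {M N : DegZero k (GrMod k 𝒮)} (f : M ⟶ N)

/-- The inclusion of the kernel. -/
def kerι : DegZero.of (kerObj f) ⟶ M := homMk (LinearMap.ker (homMap f)).subtype fun _ _ hx => hx

theorem kerι_comp : kerι f ≫ f = 0 := hom_ext fun x => x.2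

/-- The projection to the cokernel. -/
def cokerπ : N ⟶ DegZero.of (cokerObj f) :=
  homMk (LinearMap.range (homMap f)).mkQ fun _ x hx => ⟨x, hx, rfl⟩

theorem comp_cokerπ : f ≫ cokerπ f = 0 :=
  hom_ext fun x => (Submodule.Quotient.mk_eq_zero _).mpr ⟨x, rfl⟩

theorem homMap_eq_zero_of_comp_eq_zero {P : DegZero k (GrMod k 𝒮)} {g : N ⟶ P} (h : f ≫ g = 0)
    (x : M.obj.carrier) : homMap g (homMap f x) = 0 :=
  congrArg (fun h => homMap h x) h

/-- The kernel is a limit. -/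
def kerIsLimit : IsLimit (KernelFork.ofι (kerι f) (kerι_comp f)) :=
  KernelFork.IsLimit.ofι _ _
    (fun g h => homMk ((homMap g).codRestrict _ (homMap_eq_zero_of_comp_eq_zero g h))
      fun _ _ hx => homMap_mem g hx)
    (fun _ _ => rfl)
    (fun _ _ _ hm => hom_ext fun x => Subtype.ext (congrArg (fun h => homMap h x) hm))

/-- The cokernel is a colimit. -/
def cokerIsColimit : IsColimit (CokernelCofork.ofπ (cokerπ f) (comp_cokerπ f)) :=
  CokernelCofork.IsColimit.ofπ _ _
    (fun g h => homMk ((LinearMap.range (homMap f)).liftQ (homMap g) (by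
        rintro _ ⟨x, rfl⟩
        exact homMap_eq_zero_of_comp_eq_zero f h x))
      (by rintro i _ ⟨x, hx, rfl⟩; exact homMap_mem g hx))
    (fun _ _ => rfl)
    (fun _ _ _ hm => hom_ext fun x => by
      obtain ⟨x, rfl⟩ := Submodule.mkQ_surjective _ x
      exact congrArg (fun h => homMap h x) hm)

/-- The kernel is itself a graded module of the category, so its inclusion, which `f` kills, can be
cancelled against `f` and is zero. -/
theorem injective_of_mono [Mono f] : Function.Injective (homMap f) := by
  rw [← LinearMap.ker_eq_bot, Submodule.eq_bot_iff]
  intro x hx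
  have h : kerι f = 0 := (cancel_mono f).mp ((kerι_comp f).trans zero_comp.symm)
  exact congrArg (fun h => homMap h (⟨x, hx⟩ : LinearMap.ker (homMap f))) h

/-- Dually, the projection to the graded cokernel is killed by precomposition with `f`, hence zero,
so the range of `f` is everything. -/
theorem surjective_of_epi [Epi f] : Function.Surjective (homMap f) := by
  rw [← LinearMap.range_eq_top, eq_top_iff]
  intro x _
  have h : cokerπ f = 0 := (cancel_epi f).mp ((comp_cokerπ f).trans comp_zero.symm)
  exact (Submodule.Quotient.mk_eq_zero _).mp (congrArg (fun h => homMap h x) h)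

/-- A monomorphism is the kernel of its cokernel. -/
noncomputable abbrev normalMono [Mono f] : NormalMono f where
  Z := .of (cokerObj f)
  g := cokerπ f
  w := comp_cokerπ f
  isLimit :=
    let e := LinearEquiv.ofInjective (homMap f) (injective_of_mono f)
    have he (y : LinearMap.range (homMap f)) : homMap f (e.symm y) = y :=
      congrArg Subtype.val (e.apply_symm_apply y)
    KernelFork.IsLimit.ofι _ _
      -- A map killed by the cokernel lands in the range of `f`, where `f` can be inverted; the
      -- inverse keeps degrees by `mem_of_injective`.
      (fun {P} g h => homMk (M := P.obj) (e.symm.toLinearMap ∘ₗ (homMap g).codRestrict _ fun x =>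
          (Submodule.Quotient.mk_eq_zero _).mp (homMap_eq_zero_of_comp_eq_zero g h x))
        fun i x hx => mem_of_injective M.obj.isInternal N.obj.isInternal
          ((homMap f).restrictScalars k) (fun _ _ hx => homMap_mem f hx) (injective_of_mono f)
          (by
            change homMap f (e.symm _) ∈ _
            rw [he]
            exact homMap_mem g hx))
      (fun _ _ => hom_ext fun _ => he _)
      (fun _ _ _ hm => (cancel_mono f).mp (hm.trans (hom_ext fun _ => he _).symm))

/-- An epimorphism is the cokernel of its kernel. -/
noncomputable abbrev normalEpi [Epi f] : NormalEpi f where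
  W := .of (kerObj f)
  g := kerι f
  w := kerι_comp f
  isColimit :=
    let e := (homMap f).quotKerEquivOfSurjective (surjective_of_epi f)
    have he (x : M.obj.carrier) : e.symm (homMap f x) = Submodule.Quotient.mk x :=
      e.symm_apply_eq.mpr rfl
    have hd {P : DegZero k (GrMod k 𝒮)} (g : M ⟶ P) (h : kerι f ≫ g = 0) :
        LinearMap.ker (homMap f) ≤ LinearMap.ker (homMap g) := fun x hx =>
      homMap_eq_zero_of_comp_eq_zero (kerι f) h ⟨x, hx⟩
    have hf {P : DegZero k (GrMod k 𝒮)} (g : M ⟶ P) (h : kerι f ≫ g = 0) (x : M.obj.carrier) :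
        (LinearMap.ker (homMap f)).liftQ (homMap g) (hd g h) (e.symm (homMap f x)) =
          homMap g x := by
      rw [he]; rfl
    CokernelCofork.IsColimit.ofπ _ _
      (fun {P} g h => homMk (N := P.obj)
        ((LinearMap.ker (homMap f)).liftQ (homMap g) (hd g h) ∘ₗ e.symm.toLinearMap)
        fun i y hy => by
          obtain ⟨x, rfl⟩ := surjective_of_epi f y
          -- The preimage `x` of the homogeneous `y` need not be homogeneous. It is replaced by a
          -- homogeneous `z` with the same image, at which the induced map takes the value `g z`.
          obtain ⟨z, hz, hzx⟩ := exists_homogeneous_preimage M.obj.isInternal N.obj.isInternal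
            ((homMap f).restrictScalars k) (fun _ _ hx => homMap_mem f hx) hy
          change homMap f z = homMap f x at hzx
          rw [← hzx]
          change (LinearMap.ker (homMap f)).liftQ (homMap g) (hd g h) (e.symm (homMap f z)) ∈ _
          rw [hf g h]
          exact homMap_mem g hz)
      (fun g h => hom_ext fun x => hf g h x)
      (fun g h _ hm => (cancel_epi f).mp (hm.trans (hom_ext fun x => (hf g h x).symm)))

end

theorem isGradedAbelian : IsGradedAbelian k (GrMod k 𝒮) := by
  refine ⟨?_, fun M j => ?_⟩
  · have := hasFiniteProducts (k := k) (𝒮 := 𝒮)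
    have : HasKernels (DegZero k (GrMod k 𝒮)) := ⟨fun f => ⟨⟨_, kerIsLimit f⟩⟩⟩
    have : HasCokernels (DegZero k (GrMod k 𝒮)) := ⟨fun f => ⟨⟨_, cokerIsColimit f⟩⟩⟩
    exact ⟨{ normalMonoOfMono := fun f => ⟨normalMono f⟩
             normalEpiOfEpi := fun f => ⟨normalEpi f⟩ }, rfl⟩
  · have h : (LinearMap.id : M.carrier →ₗ[S] M.carrier) ∈ mapDeg M (M.shiftObj j) j := by
      intro i x hx
      change x ∈ M.gr (i + j - j)
      rwa [add_sub_cancel_right]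
    have h' : (LinearMap.id : M.carrier →ₗ[S] M.carrier) ∈ mapDeg (M.shiftObj j) M (-j) :=
      fun i x hx => hx
    exact ⟨M.shiftObj j, ⟨⟨LinearMap.id, Submodule.mem_iSup_of_mem j h⟩,
      ⟨LinearMap.id, Submodule.mem_iSup_of_mem (-j) h'⟩, rfl, rfl⟩, h, h'⟩

end GrMod

/-! ### Factorization of identities through `A^n` -/

section Factorization

open PiTensorProduct

/-- If the identity of `V` is a sum of endomorphisms `e i` of degree `0` such that any `d` of them
factor compatibly through `X`, then the identity of `V` in `Γ^d C` is a sum of morphisms that factor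
through `X`. -/
theorem DivPowCat.exists_factorization {k : Type u} [Field k] (d : ℕ) {C : Type w} [Category.{v} C]
    [Preadditive C] [Linear k C] [GradedCategory k C] (V X : C) {ι : Type} [Fintype ι]
    (e : ι → (V ⟶ V)) (he : ∀ i, e i ∈ GradedCategory.deg (k := k) V V 0) (hsum : ∑ i, e i = 𝟙 V)
    (hX : ∀ I : Finset ι, I.card ≤ d → ∃ a ∈ GradedCategory.deg (k := k) V X 0,
      ∃ b ∈ GradedCategory.deg (k := k) X V 0, ∀ i ∈ I, e i ≫ a ≫ b = e i) :
    ∃ (κ : Type) (_ : Fintype κ) (α : κ → ((of V : DivPowCat k d C) ⟶ of X))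
      (β : κ → ((of X : DivPowCat k d C) ⟶ of V)),
      (∀ I, α I ∈ GradedCategory.deg (k := k) (of V : DivPowCat k d C) (of X) 0) ∧
      (∀ I, β I ∈ GradedCategory.deg (k := k) (of X : DivPowCat k d C) (of V) 0) ∧
      ∑ I, α I ≫ β I = 𝟙 (of V) := by
  classical
  choose a ha b hb hab using hX
  let κ := {I : Finset ι // I.card ≤ d}
  -- The tensor power of `∑ e i` expands into one tensor for each `f : Fin d → ι`. Permuting the
  -- tensor factors does not change the image of `f`, so the tensors with a given image `I` add up
  -- to a symmetric tensor `P I`.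
  let s (I : Finset ι) : Finset (Fin d → ι) := {f | Finset.univ.image f = I}
  let P (I : Finset ι) : ⨂[k] _ : Fin d, (V ⟶ V) := ∑ f ∈ s I, tprod k fun l => e (f l)
  have hs (I : Finset ι) (f : Fin d → ι) : f ∈ s I ↔ Finset.univ.image f = I := by simp [s]
  have hP (I : Finset ι) : P I ∈ divPow k d (V ⟶ V) := fun σ => by
    simp only [P, map_sum, reindex_tprod]
    refine Finset.sum_equiv (Equiv.arrowCongr σ (Equiv.refl ι)) (fun f => ?_) fun f _ => rfl
    rw [hs, hs]
    have : Finset.univ.image (Equiv.arrowCongr σ (Equiv.refl ι) f) = Finset.univ.image f := by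
      ext i
      simp only [Finset.mem_image, Finset.mem_univ, true_and]
      exact ⟨fun ⟨l, hl⟩ => ⟨σ.symm l, hl⟩, fun ⟨l, hl⟩ => ⟨σ l, by simpa using hl⟩⟩
    rw [this]
  have hP0 (I : Finset ι) :
      P I ∈ tensorDeg d (GradedCategory.deg (k := k) V V) 0 :=
    Submodule.sum_mem _ fun f _ =>
      Submodule.subset_span ⟨fun _ => 0, fun l => e (f l), fun l => he _, by simp, rfl⟩
  let p (I : Finset ι) : (of V : DivPowCat k d C) ⟶ of V := ⟨P I, hP I⟩
  let α' (I : κ) : (of V : DivPowCat k d C) ⟶ of X := ⟨tprod k fun _ => a I.1 I.2, tprod_mem_divPow _⟩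
  let β (I : κ) : (of X : DivPowCat k d C) ⟶ of V := ⟨tprod k fun _ => b I.1 I.2, tprod_mem_divPow _⟩
  -- The symmetric tensor `P I` is absorbed into the first factor. Every `e i` occurring in it has
  -- `i ∈ I`, so composing with `a ≫ b` in each tensor position leaves it unchanged.
  refine ⟨κ, inferInstance, fun I => p I.1 ≫ α' I, β, fun I => ?_, fun I => ?_, ?_⟩
  · exact GradedCategory.comp_mem' (k := k) (i := 0) (j := 0) (hP0 I.1)
      (tprod_mem_tensorDeg_zero (ha I.1 I.2)) (zero_add 0)
  · exact tprod_mem_tensorDeg_zero (hb I.1 I.2)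
  · have hcomp (I : κ) : (p I.1 ≫ α' I) ≫ β I = p I.1 := by
      refine Subtype.ext ?_
      change PiTensorProduct.map₂ (fun _ => Linear.comp V X V)
        (PiTensorProduct.map₂ (fun _ => Linear.comp V V X) (P I.1) (tprod k fun _ => a I.1 I.2))
        (tprod k fun _ => b I.1 I.2) = P I.1
      simp only [P, map_sum, LinearMap.sum_apply, map₂_tprod_tprod]
      refine Finset.sum_congr rfl fun f hf => congrArg _ (funext fun l => ?_)
      rw [hs] at hf
      have := hab I.1 I.2 (f l) (hf ▸ Finset.mem_image_of_mem f (Finset.mem_univ l))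
      rw [← Category.assoc] at this
      exact this
    rw [Finset.sum_congr rfl fun I _ => hcomp I]
    -- A function on `Fin d` takes at most `d` values, so the groups left out of `κ` are empty sums.
    have h0 (I : Finset ι) (hI : ¬ I.card ≤ d) : p I = 0 := by
      refine Subtype.ext (Finset.sum_eq_zero fun f hf => (hI ?_).elim)
      rw [hs] at hf
      rw [← hf]
      exact Finset.card_image_le.trans (by simp)
    have h1 : ∑ I : κ, p I.1 = ∑ I, p I := by
      rw [← Finset.sum_subtype {I : Finset ι | I.card ≤ d} (by simp) p]
      exact Finset.sum_filter_of_ne fun I _ hI => not_imp_comm.mp (h0 I) hI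
    rw [h1]
    refine Subtype.ext ?_
    have h2 : (∑ I, p I).1 = ∑ I, P I :=
      map_sum (divPow k d (V ⟶ V)).subtype p Finset.univ
    rw [h2]
    change ∑ I, ∑ f ∈ s I, tprod k (fun l => e (f l)) = tprod k fun _ => 𝟙 V
    rw [← hsum, MultilinearMap.map_sum]
    exact Finset.sum_fiberwise Finset.univ (fun f => Finset.univ.image f) _

end Factorization

/-- Some endomorphism that fixes `n` given basis vectors factors through `k^n`. -/
theorem exists_factorization_of_card_le {k V ι : Type*} [Field k] [AddCommGroup V] [Module k V]
    (b : Module.Basis ι k V) {n : ℕ} (I : Finset ι) (hI : I.card ≤ n) :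
    ∃ (f : V →ₗ[k] Fin n → k) (g : (Fin n → k) →ₗ[k] V), ∀ i ∈ I, g (f (b i)) = b i := by
  classical
  obtain ⟨φ⟩ : Nonempty (I ↪ Fin n) := Function.Embedding.nonempty_of_card_le (by simpa)
  -- An injection of `I` into `Fin n` sends the chosen basis vectors to distinct standard ones, and
  -- `g` sends these back. The zero values elsewhere are immaterial.
  refine ⟨b.constr k fun i => if h : i ∈ I then Pi.single (φ ⟨i, h⟩) 1 else 0,
    (Pi.basisFun k (Fin n)).constr k (Function.extend φ (fun i => b i) 0), fun i hi => ?_⟩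
  rw [Module.Basis.constr_basis, dif_pos hi, ← Pi.basisFun_apply, Module.Basis.constr_basis,
    φ.injective.extend_apply]

/-- For `n ≥ d`, the identity of every object of `Γ^d V_A` is a sum of morphisms of degree `0` that
factor through `A^n`. -/
theorem exists_factorization_freeObj {k : Type u} [Field k] (p : ℕ) {d n : ℕ} (hdn : d ≤ n)
    (V : DivPowCat k d (FreeModCat k p)) :
    ∃ (κ : Type) (_ : Fintype κ) (α : κ → (V ⟶ freeObj k p d n)) (β : κ → (freeObj k p d n ⟶ V)),
      (∀ I, α I ∈ GradedCategory.deg (k := k) V (freeObj k p d n) 0) ∧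
      (∀ I, β I ∈ GradedCategory.deg (k := k) (freeObj k p d n) V 0) ∧
      ∑ I, α I ≫ β I = 𝟙 V := by
  let b := Module.finBasis k V.obj.space
  have h0 {H : Type u} [AddCommGroup H] [Module k H] (h : H) :
      h ⊗ₜ (1 : TruncPoly k p) ∈ tensorTruncDeg k p H 0 :=
    Submodule.subset_span ⟨h, 1, one_mem_truncDeg k p, rfl⟩
  -- The `e i` are the projections onto the lines of a basis of the underlying space. They have
  -- degree 0 because their coefficient in `A` is `1`.
  refine DivPowCat.exists_factorization d V.obj (freeObj k p d n).obj
    (fun i => ((b.coord i).smulRight (b i)) ⊗ₜ (1 : TruncPoly k p)) (fun i => h0 _) ?_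
    fun I hI => ?_
  · change ∑ i, ((b.coord i).smulRight (b i)) ⊗ₜ[k] (1 : TruncPoly k p) = LinearMap.id ⊗ₜ 1
    rw [← TensorProduct.sum_tmul]
    congr 1
    ext x
    simp [LinearMap.sum_apply, b.sum_repr]
  · obtain ⟨f, g, hfg⟩ := exists_factorization_of_card_le b I (hI.trans hdn)
    refine ⟨f ⊗ₜ (1 : TruncPoly k p), h0 f, g ⊗ₜ (1 : TruncPoly k p), h0 g, fun i hi => ?_⟩
    change ((g ∘ₗ f) ∘ₗ (b.coord i).smulRight (b i)) ⊗ₜ[k] (1 * (1 * 1) : TruncPoly k p) = _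
    rw [mul_one, mul_one]
    congr 1
    ext x
    simp [hfg i hi]

/-! ### Graded functors as graded modules over the endomorphism algebra of a generator -/

section

variable {k κ M Q : Type*} [Field k] [AddCommGroup M] [Module k M] [AddCommGroup Q] [Module k Q]
  {gr : ℤ → Submodule k M}

/-- Together with `finite_of_injective_pi`, this passes boundedness below and finiteness in each
degree from `M` to a graded space embedded in a power of `M`. -/
theorem eq_bot_of_injective_pi {G : Submodule k M} (hG : G = ⊥) {N : Submodule k Q}
    (e : Q →ₗ[k] (κ → M)) (hinj : Function.Injective e) (he : ∀ φ ∈ N, ∀ i, e φ i ∈ G) :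
    N = ⊥ := by
  subst hG
  refine (Submodule.eq_bot_iff _).mpr fun φ hφ => hinj ?_
  rw [map_zero]
  exact funext fun i => he φ hφ i

variable [Fintype κ]

/-- A retract of a power of a graded space is graded. -/
theorem isInternal_of_retract (h : DirectSum.IsInternal gr) (N : ℤ → Submodule k Q)
    (e : Q →ₗ[k] (κ → M)) (r : (κ → M) →ₗ[k] Q) (hr : ∀ φ, r (e φ) = φ)
    (he : ∀ j, ∀ φ ∈ N j, ∀ i, e φ i ∈ gr j)
    (hN : ∀ (j : ℤ) (x : κ → M), (∀ i, x i ∈ gr j) → r x ∈ N j) : DirectSum.IsInternal N := by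
  refine DirectSum.isInternal_submodule_of_iSupIndep_of_iSup_eq_top ?_ ?_
  · have h := h.submodule_iSupIndep
    rw [iSupIndep_iff_finsetSum_eq_zero_imp_eq_zero] at h ⊢
    intro s φ hφ hφ0 j hj
    refine Function.LeftInverse.injective hr (funext fun i => ?_)
    rw [map_zero]
    refine h s (fun j => e (φ j) i) (fun j hj => he j _ (hφ j hj) i) ?_ j hj
    have h1 := congrFun (congrArg e hφ0) i
    simpa using h1
  · classical
    rw [eq_top_iff]
    intro φ _
    -- Spanning: `φ` is the image under `r` of the tuple `e φ`, whose coordinates are decomposed in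
    -- `M` one at a time.
    rw [← hr φ, ← Finset.univ_sum_single (e φ), map_sum]
    refine Submodule.sum_mem _ fun i _ => ?_
    have hle : (⊤ : Submodule k M) ≤ (⨆ j, N j).comap (r ∘ₗ LinearMap.single k (fun _ => M) i) := by
      rw [← h.submodule_iSup_eq_top]
      refine iSup_le fun j y hy => Submodule.mem_iSup_of_mem j (hN j _ fun l => ?_)
      by_cases hl : l = i
      · subst hl; simpa using hy
      · simp [hl]
    exact hle (Submodule.mem_top (x := e φ i))

theorem finite_of_injective_pi {G : Submodule k M} [Module.Finite k G] {N : Submodule k Q}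
    (e : Q →ₗ[k] (κ → M)) (hinj : Function.Injective e) (he : ∀ φ ∈ N, ∀ i, e φ i ∈ G) :
    Module.Finite k N :=
  Module.Finite.of_injective
    (LinearMap.pi fun i => (LinearMap.proj i ∘ₗ e).restrict (p := N) (q := G) fun φ hφ => he φ hφ i)
    fun _ _ h => Subtype.ext (hinj (funext fun i =>
      congrArg (fun z : G => (z : M)) (congrFun h i)))

end

/-! ### The coinduction functor from `S`-modules to graded functors -/

section Coinduction

variable {k : Type u} [Field k] {C : Type w} [Category.{u} C] [Preadditive C] [Linear k C]
  [GradedCategory k C] {S : Type u} [Ring S] [Algebra k S] {𝒮 : ℤ → Submodule k S}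

/-- An identification of the graded algebra `S` with the opposite of the endomorphism algebra of
`E`, in which the product is the composition in diagrammatic order. -/
structure EndAlgebra (𝒮 : ℤ → Submodule k S) (E : C) where
  /-- the identification -/
  toHom : S ≃ₗ[k] (E ⟶ E)
  map_one : toHom 1 = 𝟙 E
  map_mul (s t : S) : toHom (s * t) = toHom t ≫ toHom s
  map_mem {s : S} {i : ℤ} (hs : s ∈ 𝒮 i) : toHom s ∈ GradedCategory.deg (k := k) E E i
  symm_mem {f : E ⟶ E} {i : ℤ} (hf : f ∈ GradedCategory.deg (k := k) E E i) : toHom.symm f ∈ 𝒮 i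

/-- A decomposition of the identity of `V` as a sum of morphisms of degree `0` that factor through
`E`. -/
structure Factorization (k : Type u) [Field k] {C : Type w} [Category.{u} C] [Preadditive C]
    [Linear k C] [GradedCategory k C] (E V : C) where
  /-- the index set -/
  κ : Type
  [fintype : Fintype κ]
  /-- the first factors -/
  α : κ → (V ⟶ E)
  /-- the second factors -/
  β : κ → (E ⟶ V)
  α_mem (i : κ) : α i ∈ GradedCategory.deg (k := k) V E 0
  β_mem (i : κ) : β i ∈ GradedCategory.deg (k := k) E V 0
  sum_eq : ∑ i, α i ≫ β i = 𝟙 V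

attribute [instance] Factorization.fintype

variable {E : C} (θ : EndAlgebra 𝒮 E)

theorem EndAlgebra.symm_comp (f g : E ⟶ E) :
    θ.toHom.symm (f ≫ g) = θ.toHom.symm g * θ.toHom.symm f := by
  rw [LinearEquiv.symm_apply_eq, θ.map_mul]
  simp

theorem EndAlgebra.symm_id : θ.toHom.symm (𝟙 E) = 1 := by
  rw [LinearEquiv.symm_apply_eq, θ.map_one]

variable [GradedAlgebra 𝒮] (M N : GrMod k 𝒮) (V W : C)

/-- The `S`-linear maps `Hom(V, E) → M`, where `S` acts on `Hom(V, E)` by composition. -/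
def coind : Submodule k ((V ⟶ E) →ₗ[k] M.carrier) where
  carrier := {φ | ∀ (f : V ⟶ E) (g : E ⟶ E), φ (f ≫ g) = θ.toHom.symm g • φ f}
  add_mem' {φ ψ} hφ hψ f g := by
    simp only [LinearMap.add_apply, smul_add, hφ f g, hψ f g]
  zero_mem' f g := by simp
  smul_mem' c φ hφ f g := by
    simp only [LinearMap.smul_apply, hφ f g, smul_comm _ c]

/-- The maps of degree `j` in `coind θ M V`. -/
def coindDeg (j : ℤ) : Submodule k (coind θ M V) where
  carrier := {φ | ∀ a, ∀ f ∈ GradedCategory.deg (k := k) V E a, φ.1 f ∈ M.gr (j + a)}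
  add_mem' hφ hψ a f hf := Submodule.add_mem _ (hφ a f hf) (hψ a f hf)
  zero_mem' _ _ _ := Submodule.zero_mem _
  smul_mem' c _ hφ a f hf := Submodule.smul_mem _ c (hφ a f hf)

variable {V W}

namespace Factorization

variable (F : Factorization k E V)

/-- The evaluation of an element of `coind θ M V` at the first factors. -/
def eval : coind θ M V →ₗ[k] (F.κ → M.carrier) :=
  LinearMap.pi fun i => LinearMap.applyₗ (F.α i) ∘ₗ (coind θ M V).subtype

/-- The element of `coind θ M V` given by a family of elements of `M`. -/
def lift : (F.κ → M.carrier) →ₗ[k] coind θ M V :=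
  LinearMap.codRestrict (coind θ M V)
    (LinearMap.mk₂ k
      (fun (x : F.κ → M.carrier) (f : V ⟶ E) => ∑ i, θ.toHom.symm (F.β i ≫ f) • x i)
      (fun x y f => by simp only [Pi.add_apply, smul_add, Finset.sum_add_distrib])
      (fun c x f => by simp only [Pi.smul_apply, Finset.smul_sum, smul_comm _ c])
      (fun x f g => by simp only [Preadditive.comp_add, map_add, add_smul, Finset.sum_add_distrib])
      (fun c x f => by simp only [Linear.comp_smul, map_smul, smul_assoc, Finset.smul_sum]))
    fun x f g => by
      simp only [LinearMap.mk₂_apply, Finset.smul_sum, ← Category.assoc, θ.symm_comp _ g, mul_smul]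

variable {M}

theorem eval_mem (j : ℤ) (φ : coind θ M V) (hφ : φ ∈ coindDeg θ M V j)
    (i : F.κ) : F.eval θ M φ i ∈ M.gr j := by
  have := hφ 0 _ (F.α_mem i)
  rwa [add_zero] at this

theorem lift_apply (x : F.κ → M.carrier) (f : V ⟶ E) :
    (F.lift θ M x).1 f = ∑ i, θ.toHom.symm (F.β i ≫ f) • x i := rfl

theorem lift_mem (j : ℤ) (x : F.κ → M.carrier) (hx : ∀ i, x i ∈ M.gr j) :
    F.lift θ M x ∈ coindDeg θ M V j := by
  intro a f hf
  rw [lift_apply, add_comm]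
  exact Submodule.sum_mem _ fun i _ => M.smul_mem
    (θ.symm_mem (GradedCategory.comp_mem' (F.β_mem i) hf (zero_add a))) (hx i)

/-- Since `f` is the sum of the `α i ≫ (β i ≫ f)`, where `β i ≫ f` is an endomorphism of `E`,
linearity over `S` determines `φ f` from the values `φ (α i)`. This exhibits `coind θ M V` as a
retract of a finite power of `M`. -/
theorem lift_eval (φ : coind θ M V) : F.lift θ M (F.eval θ M φ) = φ := by
  refine Subtype.ext (LinearMap.ext fun f => ?_)
  conv_rhs => rw [← Category.id_comp f, ← F.sum_eq, Preadditive.sum_comp, map_sum]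
  refine Finset.sum_congr rfl fun i _ => ?_
  rw [Category.assoc]
  exact (φ.2 _ _).symm

theorem eval_injective : Function.Injective (F.eval θ M) :=
  Function.LeftInverse.injective (F.lift_eval θ)

end Factorization

variable (H : ∀ V : C, Nonempty (Factorization k E V))

/-- The graded space of `S`-linear maps `Hom(V, E) → M`. -/
def coindVect (V : C) : GrVect k where
  carrier := coind θ M V
  gr := coindDeg θ M V
  -- A factorization is used only to prove properties; the space and its grading do not depend on
  -- its choice.
  isInternal := (H V).elim fun F => isInternal_of_retract M.isInternal (coindDeg θ M V)
    (F.eval θ M) (F.lift θ M) (F.lift_eval θ) (F.eval_mem θ) (F.lift_mem θ)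
  finite j := (H V).elim fun F =>
    have := M.finite j
    finite_of_injective_pi (G := M.gr j) (F.eval θ M) (F.eval_injective θ) (F.eval_mem θ j)
  bddBelow := (H V).elim fun F => M.bddBelow.imp fun _ hm j hj =>
    eq_bot_of_injective_pi (hm j hj) (F.eval θ M) (F.eval_injective θ) (F.eval_mem θ j)

/-- Precomposition with `g`. -/
def coindMap : (V ⟶ W) →ₗ[k] (coindVect θ M H V).carrier →ₗ[k] (coindVect θ M H W).carrier :=
  (LinearMap.mk₂ k
    (fun g φ => ⟨φ.1 ∘ₗ Linear.leftComp k _ g, fun f f' => by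
      change φ.1 (g ≫ f ≫ f') = _ • φ.1 (g ≫ f)
      rw [← Category.assoc]
      exact φ.2 _ _⟩)
    (fun g g' φ => Subtype.ext (LinearMap.ext fun f => by
      change φ.1 ((g + g') ≫ f) = φ.1 (g ≫ f) + φ.1 (g' ≫ f)
      rw [Preadditive.add_comp, map_add]))
    (fun c g φ => Subtype.ext (LinearMap.ext fun f => by
      change φ.1 ((c • g) ≫ f) = c • φ.1 (g ≫ f)
      rw [Linear.smul_comp, map_smul]))
    (fun _ _ _ => rfl) (fun _ _ _ => rfl) : (V ⟶ W) →ₗ[k] coind θ M V →ₗ[k] coind θ M W)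

theorem coindMap_mem {g : V ⟶ W} {j : ℤ} (hg : g ∈ GradedCategory.deg (k := k) V W j) :
    coindMap θ M H g ∈ GrVect.mapDeg (coindVect θ M H V) (coindVect θ M H W) j := by
  intro i φ hφ a f hf
  rw [add_assoc]
  exact hφ _ _ (GradedCategory.comp_mem hg hf)

/-- Morphisms of `V^{f+}` must be finite sums of homogeneous maps. Splitting `g` into homogeneous
parts gives this, as the construction is linear in `g`. -/
theorem coindMap_mem_homs (g : V ⟶ W) :
    coindMap θ M H g ∈ GrVect.homs (coindVect θ M H V) (coindVect θ M H W) := by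
  refine GradedCategory.hom_induction k g
    (motive := fun g => coindMap θ M H g ∈ GrVect.homs (coindVect θ M H V) (coindVect θ M H W))
    (fun j g hg => Submodule.mem_iSup_of_mem j (coindMap_mem θ M H hg)) ?_ fun f g hf hg => ?_
  · rw [map_zero]; exact Submodule.zero_mem _
  · rw [map_add]; exact Submodule.add_mem _ hf hg

/-- The functor `V ↦ Hom_S(Hom(V, E), M)`. -/
def coindFunctor : GradedFunctor k C (GrVect k) where
  toFunctor :=
    { obj := coindVect θ M H
      map := fun g => ⟨coindMap θ M H g, coindMap_mem_homs θ M H g⟩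
      map_id := fun _ => Subtype.ext (LinearMap.ext fun φ => Subtype.ext (LinearMap.ext fun f =>
        congrArg φ.1 (Category.id_comp f)))
      map_comp := fun g h => Subtype.ext (LinearMap.ext fun φ => Subtype.ext (LinearMap.ext fun f =>
        congrArg φ.1 (Category.assoc g h f))) }
  additive := ⟨fun {_ _} {f g} => Subtype.ext (map_add (coindMap θ M H) f g)⟩
  linear := ⟨fun g c => Subtype.ext (map_smul (coindMap θ M H) c g)⟩
  map_mem hg := coindMap_mem θ M H hg

variable {M N}

/-- Postcomposition with an `S`-linear map. -/
def coindPost (V : C) (h : M.carrier →ₗ[S] N.carrier) :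
    (coindVect θ M H V).carrier →ₗ[k] (coindVect θ N H V).carrier :=
  LinearMap.restrict (p := coind θ M V) (q := coind θ N V)
    (LinearMap.compRight k (h.restrictScalars k)) fun φ hφ f g => by
      change h (φ (f ≫ g)) = _ • h (φ f)
      rw [hφ f g, map_smul]

theorem coindPost_mem (V : C) {h : M.carrier →ₗ[S] N.carrier} {j : ℤ}
    (hh : h ∈ GrMod.mapDeg M N j) :
    coindPost θ H V h ∈ GrVect.mapDeg (coindVect θ M H V) (coindVect θ N H V) j := by
  intro i φ hφ a f hf
  rw [add_right_comm]
  exact hh _ _ (hφ a f hf)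

theorem coindPost_mem_homs (V : C) (h : M ⟶ N) :
    coindPost θ H V (Subtype.val h) ∈ GrVect.homs (coindVect θ M H V) (coindVect θ N H V) :=
  GradedCategory.hom_induction k h
    (motive := fun h : M ⟶ N => coindPost θ H V (Subtype.val h) ∈
      GrVect.homs (coindVect θ M H V) (coindVect θ N H V))
    (fun j _ hh => Submodule.mem_iSup_of_mem j (coindPost_mem θ H V hh)) (Submodule.zero_mem _)
    fun _ _ hf hg => Submodule.add_mem _ hf hg

/-- The natural transformation induced by a morphism of graded modules. -/
def coindNat (h : M ⟶ N) :
    (coindFunctor θ M H).toFunctor ⟶ (coindFunctor θ N H).toFunctor where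
  app V := ⟨coindPost θ H V (Subtype.val h), coindPost_mem_homs θ H V h⟩
  naturality _ _ _ := rfl

theorem coindNat_mem {h : M ⟶ N} {j : ℤ} (hh : h ∈ GradedCategory.deg (k := k) M N j) :
    coindNat θ H h ∈ GradedFunctor.natDeg (coindFunctor θ M H) (coindFunctor θ N H) j :=
  fun V => coindPost_mem θ H V hh

theorem coindNat_mem_homs (h : M ⟶ N) :
    coindNat θ H h ∈ GradedFunctor.homs (coindFunctor θ M H) (coindFunctor θ N H) :=
  GradedCategory.hom_induction k h
    (motive := fun h => coindNat θ H h ∈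
      GradedFunctor.homs (coindFunctor θ M H) (coindFunctor θ N H))
    (fun j _ hh => Submodule.mem_iSup_of_mem j (coindNat_mem θ H hh)) (Submodule.zero_mem _)
    fun _ _ hf hg => Submodule.add_mem _ hf hg

/-- The graded functor `M ↦ Hom_S(Hom(-, E), M)`. -/
def coindGraded : GradedFunctor k (GrMod k 𝒮) (GradedFunctor k C (GrVect k)) where
  toFunctor :=
    { obj := fun M => coindFunctor θ M H
      map := fun h => ⟨coindNat θ H h, coindNat_mem_homs θ H h⟩
      map_id := fun _ => rfl
      map_comp := fun _ _ => rfl }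
  additive := ⟨rfl⟩
  linear := ⟨fun _ _ => rfl⟩
  map_mem hf := coindNat_mem θ H hf

end Coinduction

/-! ### Evaluation at `E` is inverse to coinduction -/

section Morita

variable {k : Type u} [Field k] {C : Type w} [Category.{u} C] [Preadditive C] [Linear k C]
  [GradedCategory k C] {S : Type u} [Ring S] [Algebra k S] {𝒮 : ℤ → Submodule k S}
  [GradedAlgebra 𝒮] {E : C} (θ : EndAlgebra 𝒮 E)

/-- The action of the endomorphism algebra of `E` on `F(E)`. -/
abbrev evalAtModule (F : GradedFunctor k C (GrVect k)) :
    Module S (F.toFunctor.obj E).carrier where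
  smul s x := (F.toFunctor.map (θ.toHom s)).1 x
  one_smul x := by
    change (F.toFunctor.map (θ.toHom 1)).1 x = x
    rw [θ.map_one, F.toFunctor.map_id]; rfl
  mul_smul s t x := by
    change (F.toFunctor.map (θ.toHom (s * t))).1 x = _
    rw [θ.map_mul, F.toFunctor.map_comp]; rfl
  smul_zero s := map_zero _
  smul_add s x y := map_add _ x y
  add_smul s t x := by
    change (F.toFunctor.map (θ.toHom (s + t))).1 x = _
    rw [map_add, F.toFunctor.map_add]; rfl
  zero_smul x := by
    change (F.toFunctor.map (θ.toHom 0)).1 x = _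
    rw [map_zero, F.toFunctor.map_zero]; rfl

/-- `F(E)` as a graded module over the endomorphism algebra of `E`. -/
def evalAtObj (F : GradedFunctor k C (GrVect k)) : GrMod k 𝒮 where
  toGrVect := F.toFunctor.obj E
  moduleAlg := evalAtModule θ F
  isScalarTower :=
    letI := evalAtModule θ F
    ⟨fun c s x => by
      change (F.toFunctor.map (θ.toHom (c • s))).1 x = c • (F.toFunctor.map (θ.toHom s)).1 x
      rw [map_smul, F.toFunctor.map_smul]; rfl⟩
  smul_mem {i j s x} hs hx := by
    rw [add_comm]
    exact F.map_mem (θ.map_mem hs) j x hx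

theorem evalAtObj_smul (F : GradedFunctor k C (GrVect k)) (s : S) (x : (evalAtObj θ F).carrier) :
    s • x = (F.toFunctor.map (θ.toHom s)).1 x := rfl

/-- The component at `E` of a natural transformation, as a module homomorphism. -/
def evalAtMap {F G : GradedFunctor k C (GrVect k)} (η : F.toFunctor ⟶ G.toFunctor) :
    (evalAtObj θ F).carrier →ₗ[S] (evalAtObj θ G).carrier where
  toFun := (η.app E).1
  map_add' := map_add _
  map_smul' s x := DFunLike.congr_fun (congrArg Subtype.val (η.naturality (θ.toHom s))) x

theorem evalAtMap_mem {F G : GradedFunctor k C (GrVect k)} {j : ℤ} {η : F.toFunctor ⟶ G.toFunctor}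
    (hη : η ∈ GradedFunctor.natDeg F G j) :
    evalAtMap θ η ∈ GrMod.mapDeg (evalAtObj θ F) (evalAtObj θ G) j := hη E

theorem evalAtMap_mem_homs {F G : GradedFunctor k C (GrVect k)} (η : F ⟶ G) :
    evalAtMap θ (Subtype.val η) ∈ GrMod.homs (evalAtObj θ F) (evalAtObj θ G) :=
  GradedCategory.hom_induction k η
    (motive := fun η : F ⟶ G => evalAtMap θ (Subtype.val η) ∈
      GrMod.homs (evalAtObj θ F) (evalAtObj θ G))
    (fun j _ hη => Submodule.mem_iSup_of_mem j (evalAtMap_mem θ hη)) (Submodule.zero_mem _)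
    fun _ _ hf hg => Submodule.add_mem _ hf hg

/-- Evaluation of graded functors at `E`. -/
def evalAt : GradedFunctor k (GradedFunctor k C (GrVect k)) (GrMod k 𝒮) where
  toFunctor :=
    { obj := fun F => evalAtObj θ F
      map := fun η => ⟨evalAtMap θ (Subtype.val η), evalAtMap_mem_homs θ η⟩
      map_id := fun _ => rfl
      map_comp := fun _ _ => rfl }
  additive := ⟨rfl⟩
  linear := ⟨fun _ _ => rfl⟩
  map_mem hf := evalAtMap_mem θ hf

namespace GrVect

/-- A bijective map of degree `0` as an isomorphism of degree `0`. -/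
def isoOfEquiv {M N : GrVect k} (e : M.carrier ≃ₗ[k] N.carrier)
    (he : ∀ i, ∀ x ∈ M.gr i, e x ∈ N.gr i) :
    (DegZero.of M : DegZero k (GrVect k)) ≅ DegZero.of N :=
  have h : e.toLinearMap ∈ mapDeg M N 0 := fun i x hx => by
    rw [add_zero]; exact he i x hx
  have h' : e.symm.toLinearMap ∈ mapDeg N M 0 := fun i x hx => by
    rw [add_zero]
    exact mem_of_injective M.isInternal N.isInternal e.toLinearMap he e.injective (by simpa)
  { hom := ⟨⟨e.toLinearMap, Submodule.mem_iSup_of_mem 0 h⟩, h⟩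
    inv := ⟨⟨e.symm.toLinearMap, Submodule.mem_iSup_of_mem 0 h'⟩, h'⟩
    hom_inv_id := Subtype.ext (Subtype.ext (LinearMap.ext e.symm_apply_apply))
    inv_hom_id := Subtype.ext (Subtype.ext (LinearMap.ext e.apply_symm_apply)) }

end GrVect

/-- A bijective module homomorphism of degree `0` as an isomorphism of degree `0`. -/
def GrMod.isoOfEquiv {M N : GrMod k 𝒮} (e : M.carrier ≃ₗ[S] N.carrier)
    (he : ∀ i, ∀ x ∈ M.gr i, e x ∈ N.gr i) :
    (DegZero.of M : DegZero k (GrMod k 𝒮)) ≅ DegZero.of N where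
  hom := homMk e.toLinearMap he
  inv := homMk e.symm.toLinearMap fun i x hx =>
    mem_of_injective M.isInternal N.isInternal (e.toLinearMap.restrictScalars k) he e.injective
      (by
        change e (e.symm x) ∈ _
        rwa [e.apply_symm_apply])
  hom_inv_id := hom_ext e.symm_apply_apply
  inv_hom_id := hom_ext e.apply_symm_apply

/-- The map `F(V) → Hom_S(Hom(V, E), F(E))`, `x ↦ (f ↦ F(f)(x))`. -/
def coindUnit (F : GradedFunctor k C (GrVect k)) (V : C) :
    (F.toFunctor.obj V).carrier →ₗ[k] coind θ (evalAtObj θ F) V :=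
  LinearMap.codRestrict (coind θ (evalAtObj θ F) V)
    (LinearMap.mk₂ k (fun (x : (F.toFunctor.obj V).carrier) (f : V ⟶ E) =>
        ((F.toFunctor.map f).1 x : (F.toFunctor.obj E).carrier))
      (fun x y f => map_add _ x y) (fun c x f => map_smul _ c x)
      (fun x f g => by rw [F.toFunctor.map_add]; rfl)
      (fun c x f => by rw [F.toFunctor.map_smul]; rfl))
    fun x f g => by
      change (F.toFunctor.map (f ≫ g)).1 x =
        (F.toFunctor.map (θ.toHom (θ.toHom.symm g))).1 ((F.toFunctor.map f).1 x)
      rw [LinearEquiv.apply_symm_apply, F.toFunctor.map_comp]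
      rfl

/-- This is `F` applied to the decomposition of the identity of `V`: an element of `F(V)` is rebuilt
from its images in `F(E)`. -/
theorem sum_map_comp_apply (F : GradedFunctor k C (GrVect k)) {V : C} (φ : Factorization k E V)
    (x : (F.toFunctor.obj V).carrier) :
    ∑ i, (F.toFunctor.map (φ.β i)).1 ((F.toFunctor.map (φ.α i)).1 x) = x := by
  have h : F.toFunctor.map (∑ i, φ.α i ≫ φ.β i) = 𝟙 _ := by
    rw [φ.sum_eq, F.toFunctor.map_id]
  rw [Functor.map_sum] at h
  have h1 := DFunLike.congr_fun ((map_sum (GrVect.homs _ _).subtype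
    (fun i => F.toFunctor.map (φ.α i ≫ φ.β i)) Finset.univ).symm.trans (congrArg Subtype.val h)) x
  refine Eq.trans ?_ h1
  rw [LinearMap.sum_apply]
  refine Finset.sum_congr rfl fun i _ => ?_
  rw [F.toFunctor.map_comp]
  rfl

/-- Injectivity holds because the elements `F(α i) x` already determine `x`. -/
theorem coindUnit_bijective (F : GradedFunctor k C (GrVect k)) {V : C}
    (φ : Factorization k E V) : Function.Bijective (coindUnit θ F V) := by
  refine ⟨fun x y hxy => ?_, fun t => ?_⟩
  · rw [← sum_map_comp_apply F φ x, ← sum_map_comp_apply F φ y]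
    refine Finset.sum_congr rfl fun i _ => ?_
    have h : (coindUnit θ F V x).1 (φ.α i) = (coindUnit θ F V y).1 (φ.α i) := by rw [hxy]
    exact congrArg _ h
  -- The candidate preimage of `t` is forced by `sum_map_comp_apply`. By `eval_injective` it
  -- suffices to compare with `t` at the `α j`, where the value of `t` is expanded by `lift_eval`.
  · refine ⟨∑ i, (F.toFunctor.map (φ.β i)).1 (t.1 (φ.α i)), φ.eval_injective θ ?_⟩
    refine funext fun j => ?_
    change (F.toFunctor.map (φ.α j)).1 (∑ i, (F.toFunctor.map (φ.β i)).1 (t.1 (φ.α i))) =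
      t.1 (φ.α j)
    rw [map_sum]
    conv_rhs => rw [← φ.lift_eval θ t]
    rw [φ.lift_apply]
    refine Finset.sum_congr rfl fun i _ => ?_
    rw [evalAtObj_smul, LinearEquiv.apply_symm_apply, F.toFunctor.map_comp]
    rfl

variable (H : ∀ V : C, Nonempty (Factorization k E V))

theorem coindUnit_mem (F : GradedFunctor k C (GrVect k)) (V : C) (j : ℤ)
    (x : (F.toFunctor.obj V).carrier) (hx : x ∈ (F.toFunctor.obj V).gr j) :
    coindUnit θ F V x ∈ coindDeg θ (evalAtObj θ F) V j := fun _ _ hf => F.map_mem hf j x hx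

/-- The isomorphism `F(V) ≅ Hom_S(Hom(V, E), F(E))`. -/
noncomputable def coindUnitIso (F : GradedFunctor k C (GrVect k)) (V : C) :
    (DegZero.of (F.toFunctor.obj V) : DegZero k (GrVect k)) ≅
      DegZero.of (coindVect θ (evalAtObj θ F) H V) :=
  GrVect.isoOfEquiv (N := coindVect θ (evalAtObj θ F) H V)
    (LinearEquiv.ofBijective (coindUnit θ F V) ((H V).elim fun φ => coindUnit_bijective θ F φ))
    fun j x hx => coindUnit_mem θ F V j x hx

/-- The isomorphism between the identity and evaluation followed by coinduction. -/
noncomputable def unitIso :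
    (DegZero.of (GradedFunctor.id k (GradedFunctor k C (GrVect k))) :
      DegZero k (GradedFunctor k (GradedFunctor k C (GrVect k)) (GradedFunctor k C (GrVect k)))) ≅
      DegZero.of ((evalAt θ).comp (coindGraded θ H)) :=
  GradedFunctor.isoMk
    (fun F => GradedFunctor.isoMk (G := coindFunctor θ (evalAtObj θ F) H)
      (fun V => coindUnitIso θ H F V) fun {V W} g =>
        Subtype.ext (LinearMap.ext fun x => Subtype.ext (LinearMap.ext fun f => by
          change (F.toFunctor.map f).1 ((F.toFunctor.map g).1 x) = (F.toFunctor.map (g ≫ f)).1 x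
          rw [F.toFunctor.map_comp]; rfl)))
    fun {F G} η => Subtype.ext (NatTrans.ext (funext fun V =>
      Subtype.ext (LinearMap.ext fun x => Subtype.ext (LinearMap.ext fun f =>
        (DFunLike.congr_fun (congrArg Subtype.val (η.1.naturality f)) x).symm))))

/-- The isomorphism `M ≅ Hom_S(Hom(E, E), M)`. -/
noncomputable def coindCounit (M : GrMod k 𝒮) :
    M.carrier ≃ₗ[S] (evalAtObj θ (coindFunctor θ M H)).carrier :=
  -- As in the Yoneda lemma, an `S`-linear map on `Hom(E, E)` is determined by its value at the
  -- identity, and any element of `M` occurs as that value.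
  LinearEquiv.symm
    { toFun := fun φ : coind θ M E => φ.1 (𝟙 E)
      map_add' := fun _ _ => rfl
      map_smul' := fun s φ => by
        change φ.1 (θ.toHom s ≫ 𝟙 E) = s • φ.1 (𝟙 E)
        have h := φ.2 (𝟙 E) (θ.toHom s)
        rw [LinearEquiv.symm_apply_apply, Category.id_comp] at h
        rw [Category.comp_id, h]
      invFun := fun x => ⟨(LinearMap.toSpanSingleton S M.carrier x).restrictScalars k ∘ₗ
        θ.toHom.symm.toLinearMap, fun f g => by
          change θ.toHom.symm (f ≫ g) • x = θ.toHom.symm g • θ.toHom.symm f • x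
          rw [θ.symm_comp, mul_smul]⟩
      left_inv := fun φ => Subtype.ext (LinearMap.ext fun f => by
        change θ.toHom.symm f • φ.1 (𝟙 E) = φ.1 f
        have h := φ.2 (𝟙 E) f
        rw [Category.id_comp] at h
        exact h.symm)
      right_inv := fun x => by
        change θ.toHom.symm (𝟙 E) • x = x
        rw [θ.symm_id, one_smul] }

/-- The isomorphism between the identity and coinduction followed by evaluation. -/
noncomputable def counitIso :
    (DegZero.of (GradedFunctor.id k (GrMod k 𝒮)) :
      DegZero k (GradedFunctor k (GrMod k 𝒮) (GrMod k 𝒮))) ≅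
      DegZero.of ((coindGraded θ H).comp (evalAt θ)) :=
  GradedFunctor.isoMk
    (fun M => GrMod.isoOfEquiv (N := evalAtObj θ (coindFunctor θ M H)) (coindCounit θ H M)
      fun j x hx a f hf => by
        change θ.toHom.symm f • x ∈ _
        rw [add_comm]
        exact M.smul_mem (θ.symm_mem hf) hx)
    fun {M N} h => Subtype.ext (LinearMap.ext fun x => Subtype.ext (LinearMap.ext fun f =>
      (map_smul h.1 (θ.toHom.symm f) x).symm))

/-- If every object is a graded summand of a power of `E`, then evaluation at `E` is a graded
equivalence. -/
theorem evalAt_isEquivalence (H : ∀ V : C, Nonempty (Factorization k E V)) :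
    (evalAt θ).IsEquivalence :=
  ⟨coindGraded θ H, ⟨(unitIso θ H).symm⟩, ⟨(counitIso θ H).symm⟩⟩

end Morita

/-! ### The affine Schur algebra and the evaluation functor -/

section

variable (k : Type u) [Field k] (p d n : ℕ)

/-- The affine Schur algebra as the endomorphism algebra of `A^n`. -/
noncomputable def affSchurEnd : EndAlgebra (affSchurDeg k p d n) (freeObj k p d n) where
  toHom :=
    { toFun := AffSchur.toHom
      invFun := fun f => ⟨f.1, f.2⟩
      map_add' := AffSchur.toHom_add
      map_smul' := AffSchur.toHom_smul
      left_inv := fun _ => rfl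
      right_inv := fun _ => rfl }
  map_one := AffSchur.toHom_one
  map_mul := AffSchur.toHom_mul
  map_mem := AffSchur.toHom_mem
  symm_mem hf := hf

variable {k p d n}

theorem nonempty_factorization (hdn : d ≤ n) (V : DivPowCat k d (FreeModCat k p)) :
    Nonempty (Factorization k (freeObj k p d n) V) :=
  (exists_factorization_freeObj p hdn V).elim fun κ ⟨_, α, β, hα, hβ, h⟩ => ⟨⟨κ, α, β, hα, hβ, h⟩⟩

/-- Both functors are given by the same formulas for the action, the grading and the maps, so the
general equivalence applies to `ev` without any comparison isomorphism. -/
theorem ev_eq_evalAt : AffPoly.ev k p d n = evalAt (affSchurEnd k p d n) := rfl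

end

end AffineSPF

/-- For `n ≥ d`, evaluation at `A^n` is an equivalence of graded abelian categories from the
category of affine strict polynomial functors of degree `d` to the category of graded modules over
the affine Schur algebra that are bounded below and finite dimensional in each degree. -/
theorem proposition2p5 (k : Type u) [Field k] (p : ℕ) [Fact p.Prime] [CharP k p] (d n : ℕ)
    (hdn : d ≤ n) :
    AffineSPF.IsGradedAbelian k (AffineSPF.AffPoly k p d) ∧
      AffineSPF.IsGradedAbelian k (AffineSPF.GrMod k (AffineSPF.affSchurDeg k p d n)) ∧
      (AffineSPF.AffPoly.ev k p d n).IsEquivalence := by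
  have hev : (AffineSPF.AffPoly.ev k p d n).IsEquivalence := by
    rw [AffineSPF.ev_eq_evalAt]
    exact AffineSPF.evalAt_isEquivalence _ (AffineSPF.nonempty_factorization hdn)
  -- Kernels and cokernels are never constructed for functors; the abelian structure and the shifts
  -- come from modules through `hev`.
  exact ⟨AffineSPF.GrMod.isGradedAbelian.of_isEquivalence hev, AffineSPF.GrMod.isGradedAbelian, hev⟩
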